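/- Let $X$ be a discrete memoryless source with finite alphabet $\mathsf A$ and letter law $P$, let $\mathsf B$ be a finite reproduction alphabet, and let $d:\mathsf A\times\mathsf B\to[0,\infty)$ be a (hence bounded) distortion function, extended additively to words by $d_n(x^n,y^n)=\frac1n\sum_{t=1}^n d(x_t,y_t)$. Let $$R(D)=\inf\{I(P,W): W \text{ a channel from } \mathsf A \text{ to } \mathsf B,\ \textstyle\sum_{x,y}P(x)W(y|x)d(x,y)\le D\}$$ be Shannon's rate-distortion function (logarithms to base $2$; $R(D)=+\infty$ if no such $W$ exists). Let $q$ be a prime and $\psi:\mathbb F_q\to\mathsf B$ any surjective labelling of the reproduction letters by field elements. For a probability mass function $U$ on $\mathbb F_q$, let $A^n_\epsilon(U)$ be the set of frequency-typical sequences: all $u\in\mathbb F_q^n$ in which the relative frequency of each letter $a$ differs from $U(a)$ by at most $\epsilon$ and no letter of probability $0$ occurs. An ensemble of $l\ge 1$ nested quasi-linear codes (NQLC's) of length $n$ is given by matrices $G_i\in\mathbb F_q^{k_i\times n}$ ($1\le i\le m$) common to all codes, and, for each $1\le j\le l$, a dither $\mathbf b_j\in\mathbb F_q^n$ and probability mass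 functions $U_{j,1},\dots,U_{j,m}$ on $\mathbb F_q$; the $j$-th code is $$\mathcal C_j=\Big\{\sum_{i=1}^m \mathbf u_iG_i+\mathbf b_j:\ \mathbf u_i\in A^{k_i}_\epsilon(U_{j,i})\Big\}.$$ With random binning, every word of $\mathbb F_q^n$ is assigned to one of $M$ bins. For the $j$-th code, an encoder maps the source word to a codeword of $\mathcal C_j$ and transmits the index of its bin, at rate $\frac1n\log_2 M$; the decoder outputs the unique codeword of $\mathcal C_j$ in that bin that belongs to $A^n_\epsilon(Q)$, where $Q$ is a fixed probability mass function on $\mathbb F_q$ (and the zero word if there is no such codeword or more than one), and the reproduction is obtained by applying $\psi$ letterwise. **Lemma.** NQLC's combined with random binning achieve Shannon's rate-distortion function for point-to-point source coding. That is, for every $l\ge1$, all real $D$ and $R$ with $R\ge R(D)$, and every $\delta>0$, there exist $m\ge1$, probability mass functions $U_{j,i}$ ($1\le j\le l$, $1\le i\le m$) and $Q$ on $\mathbb F_q$, and $\epsilon_0>0$, such that for every $\epsilon\in(0,\epsilon_0)$ there are lengths $k_1(n),\dots,k_m(n)$ and numbers of bins $M(n)$, which for all sufficiently large $n$ are positive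 with $\frac1n\log_2M(n)\le R+\delta$, for which the following holds. If the matrices $G_i$, the dithers $\mathbf b_j$ and the bin index of each word are drawn independently and uniformly, then for each $j$ the probability that some encoder for the $j$-th code has expected distortion at most $D+\delta$ tends to $1$ as $n\to\infty$. -/

import Mathlib

open Filter Topology

noncomputable section

/-! Single-letter quantities on finite alphabets. A probability mass function on a finite type `A`
is an element of `stdSimplex ℝ A`; a channel assigns to every input letter such a function. -/

/-- The output law of the channel `W` with input law `P`. -/
def outputLaw {A B : Type*} [Fintype A] (P : A → ℝ) (W : A → B → ℝ) (y : B) : ℝ :=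
  ∑ x, P x * W x y

/-- Mutual information, in bits, between input and output of the channel `W` with input law `P`. -/
def mutualInfo {A B : Type*} [Fintype A] [Fintype B] (P : A → ℝ) (W : A → B → ℝ) : ℝ :=
  ∑ x, ∑ y, P x * W x y * Real.logb 2 (W x y / outputLaw P W y)

/-- Expected single-letter distortion of the test channel `W`. -/
def expectedDistortion {A B : Type*} [Fintype A] [Fintype B]
    (P : A → ℝ) (d : A → B → ℝ) (W : A → B → ℝ) : ℝ :=
  ∑ x, ∑ y, P x * W x y * d x y

/-- Shannon's rate-distortion function, in bits; it is `⊤` where no test channel meets the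
distortion level `D`. -/
def rateDistortion {A B : Type*} [Fintype A] [Fintype B]
    (P : A → ℝ) (d : A → B → ℝ) (D : ℝ) : EReal :=
  ⨅ (W : A → B → ℝ) (_ : (∀ x, W x ∈ stdSimplex ℝ B) ∧ expectedDistortion P d W ≤ D),
    ((mutualInfo P W : ℝ) : EReal)

/-- The set of frequency-typical sequences of length `n` for the law `P`: every letter has relative
frequency within `ε` of its probability, and letters of probability zero do not occur. -/
def typicalSet {A : Type*} [DecidableEq A] (P : A → ℝ) (ε : ℝ) (n : ℕ) : Set (Fin n → A) :=
  {x | ∀ a, |((Finset.univ.filter fun t => x t = a).card : ℝ) - n * P a| ≤ n * ε ∧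
    (P a = 0 → ∀ t, x t ≠ a)}

/-! Codes over the prime field `ZMod q`. -/

/-- The quasi-linear code with generator matrices `G i`, dither `b` and index laws `U i`:
all words `∑ i, u i * G i + b` with `u i` typical of length `k i` for `U i`. -/
def qlc {q m n : ℕ} {k : Fin m → ℕ} (U : Fin m → ZMod q → ℝ) (ε : ℝ)
    (G : (i : Fin m) → Matrix (Fin (k i)) (Fin n) (ZMod q)) (b : Fin n → ZMod q) :
    Set (Fin n → ZMod q) :=
  {c | ∃ u : (i : Fin m) → Fin (k i) → ZMod q,
    (∀ i, u i ∈ typicalSet (U i) ε (k i)) ∧ c = (∑ i, Matrix.vecMul (u i) (G i)) + b}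

/-- An ensemble of `l` nested quasi-linear codes: the codes share the generator matrices `G i`,
while each has its own dither `b j` and its own index laws `U j`. -/
def nqlc {q l m n : ℕ} {k : Fin m → ℕ} (U : Fin l → Fin m → ZMod q → ℝ) (ε : ℝ)
    (G : (i : Fin m) → Matrix (Fin (k i)) (Fin n) (ZMod q)) (b : Fin l → Fin n → ZMod q)
    (j : Fin l) : Set (Fin n → ZMod q) :=
  qlc (U j) ε G (b j)

open Classical in
/-- The bin decoder for the code `C` binned by `bin`: from a bin index it returns the unique
codeword of that bin which is typical for the law `Q`, and the zero word if there is no codeword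
or more than one codeword of this kind. -/
def binDecoder {q n M : ℕ} (C : Set (Fin n → ZMod q)) (bin : (Fin n → ZMod q) → Fin M)
    (Q : ZMod q → ℝ) (ε : ℝ) (s : Fin M) : Fin n → ZMod q :=
  if h : ∃! c, c ∈ C ∧ bin c = s ∧ c ∈ typicalSet Q ε n then h.choose else 0

/-- Expected per-letter distortion between an i.i.d. source word with letter law `P` and its
reproduction `rec`. -/
def blockDistortion {A B : Type*} [Fintype A] (P : A → ℝ) (d : A → B → ℝ) {n : ℕ}
    (rec : (Fin n → A) → Fin n → B) : ℝ :=
  ∑ x : Fin n → A, (∏ t, P (x t)) * ((∑ t, d (x t) (rec x t)) / n)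

/-- Probability of the event `E` under the uniform distribution on the finite type `Ω`. -/
def uniformProb {Ω : Type*} (E : Set Ω) : ℝ := (E.ncard : ℝ) / (Nat.card Ω : ℝ)

/-- Everything that is drawn at random: the generator matrices, the `l` dithers, and the bin index
of every word. The uniform distribution on this type makes all of them independent and uniform. -/
abbrev CodeDraw (q l m n : ℕ) (k : Fin m → ℕ) (M : ℕ) : Type :=
  ((i : Fin m) → Matrix (Fin (k i)) (Fin n) (ZMod q)) ×
    (Fin l → Fin n → ZMod q) × ((Fin n → ZMod q) → Fin M)

/-- The draws for which some encoder, mapping source words to codewords of the `j`-th code and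
transmitting the bin index of the codeword, gives expected distortion at most `Δ` at the output of
the bin decoder followed by the letterwise labelling `ψ`. -/
def goodDraws {A B : Type*} [Fintype A] (P : A → ℝ) (d : A → B → ℝ) {q : ℕ} (ψ : ZMod q → B)
    {l m n : ℕ} {k : Fin m → ℕ} {M : ℕ} (U : Fin l → Fin m → ZMod q → ℝ) (Q : ZMod q → ℝ) (ε : ℝ)
    (j : Fin l) (Δ : ℝ) : Set (CodeDraw q l m n k M) :=
  {ω | ∃ enc : (Fin n → A) → Fin n → ZMod q,
    (∀ x, enc x ∈ nqlc U ε ω.1 ω.2.1 j) ∧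
    blockDistortion P d
      (fun x t => ψ (binDecoder (nqlc U ε ω.1 ω.2.1 j) ω.2.2 Q ε (ω.2.2 (enc x)) t)) ≤ Δ}

/-- The pair `(R, D)` is achieved by ensembles of `l` nested quasi-linear codes over `ZMod q` with
random binning: for every `δ > 0` there are index laws `U` and a decoding law `Q` such that, for
every small enough typicality parameter `ε` and suitable lengths `k n i` and numbers `M n` of bins,
the transmitted rate is at most `R + δ`, and each of the `l` codes has, with probability tending
to one, expected distortion at most `D + δ`. -/
def NQLCAchieves {A B : Type*} [Fintype A] (P : A → ℝ) (d : A → B → ℝ)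
    {q : ℕ} [NeZero q] (ψ : ZMod q → B) (l : ℕ) (R D : ℝ) : Prop :=
  ∀ δ > 0, ∃ (m : ℕ) (U : Fin l → Fin m → ZMod q → ℝ) (Q : ZMod q → ℝ),
    0 < m ∧
    (∀ j i, U j i ∈ stdSimplex ℝ (ZMod q)) ∧ Q ∈ stdSimplex ℝ (ZMod q) ∧
    ∃ ε₀ > 0, ∀ ε, 0 < ε → ε < ε₀ →
      ∃ (k : ℕ → Fin m → ℕ) (M : ℕ → ℕ),
        (∀ᶠ n in atTop, (∀ i, 0 < k n i) ∧ 0 < M n ∧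
          Real.logb 2 (M n) / n ≤ R + δ) ∧
        ∀ j : Fin l, Tendsto
          (fun n => uniformProb
            (goodDraws P d ψ U Q ε j (D + δ) : Set (CodeDraw q l m n (k n) (M n))))
          atTop (𝓝 1)

end

/-! Write `h` for the conditional entropy of a test channel `W` with values in the field, `H` for
its output entropy, and `τ` for a small slack. One generator matrix with uniform index law suffices:
almost all index vectors are then typical, so the code has about `q ^ κ` indexed words, with `q ^ κ`
near `2 ^ (n (log q - h + 2τ))`. Random matrix and dither make these words uniform and pairwise
independent (`pairwiseUniform_nqlcWord`), which is all that a second moment argument needs.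

Covering: most source words have at least about `2 ^ (n (h - τ))` jointly suitable reproductions
(`tendsto_iidProb_sparseSet`). Some codeword is among them except with probability of order `2 ^
(-nτ)` (`PairwiseUniform.card_miss_le`).

Binning: uniform codewords are far too many for the target rate, but the decoder looks only at those
typical for the output law. Their expected number is at most about `2 ^ (n (H - h + 3τ))`, so `2 ^
(n (H - h + 4τ))` bins make a collision unlikely, and `H - h` is the mutual information.

`PairwiseUniform.ncard_not_served_le` joins the two estimates. Averaging over source words and
Markov's inequality give most draws small failure probability, and bounded distortion makes failures
cheap. -/

noncomputable section

/-! ### Words with independent letters: weak law and typical sequences -/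

/-- Probability of the event `E` when `n` letters are drawn independently from the law `p`. -/
def iidProb {Z : Type*} [Fintype Z] (p : Z → ℝ) (n : ℕ) (E : Set (Fin n → Z)) : ℝ :=
  ∑ z, E.indicator (fun z => ∏ t, p (z t)) z

section IID

variable {Z : Type*} [Fintype Z] {p : Z → ℝ}

lemma sum_prod_law_eq_one (hp : p ∈ stdSimplex ℝ Z) (n : ℕ) :
    ∑ z : Fin n → Z, ∏ t, p (z t) = 1 := by
  classical
  have := Finset.prod_univ_sum (fun _ : Fin n => (Finset.univ : Finset Z)) (fun _ a => p a)
  simp only [Fintype.piFinset_univ] at this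
  rw [← this]
  simp [hp.2]

lemma prod_law_nonneg (hp : p ∈ stdSimplex ℝ Z) {n : ℕ} (z : Fin n → Z) :
    0 ≤ ∏ t, p (z t) := Finset.prod_nonneg fun t _ => hp.1 (z t)

lemma sum_fin_succ_fun {β : Type*} [AddCommMonoid β] (n : ℕ) (F : (Fin (n + 1) → Z) → β) :
    ∑ z, F z = ∑ a : Z, ∑ z : Fin n → Z, F (Fin.cons a z) := by
  rw [← Fintype.sum_prod_type']
  exact (Fintype.sum_equiv (Fin.consEquiv fun _ => Z) _ _ fun _ => rfl).symm

lemma iid_first_moment (hp : p ∈ stdSimplex ℝ Z) (g : Z → ℝ) (hg : ∑ a, p a * g a = 0) (n : ℕ) :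
    ∑ z : Fin n → Z, (∏ t, p (z t)) * ∑ t, g (z t) = 0 := by
  induction n with
  | zero => simp
  | succ n ih =>
    rw [sum_fin_succ_fun]
    have : ∀ a : Z, ∑ z : Fin n → Z, (∏ t, p ((Fin.cons a z : Fin (n + 1) → Z) t)) *
        ∑ t, g ((Fin.cons a z : Fin (n + 1) → Z) t) = p a * g a := by
      intro a
      simp only [Fin.prod_univ_succ, Fin.sum_univ_succ, Fin.cons_zero, Fin.cons_succ]
      calc _ = p a * g a * (∑ z : Fin n → Z, ∏ t, p (z t)) +
            p a * ∑ z : Fin n → Z, (∏ t, p (z t)) * ∑ t, g (z t) := by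
              rw [Finset.mul_sum, Finset.mul_sum, ← Finset.sum_add_distrib]
              exact Finset.sum_congr rfl fun z _ => by ring
        _ = _ := by rw [ih, sum_prod_law_eq_one hp]; ring
    rw [Finset.sum_congr rfl fun a _ => this a, hg]

/-- Splitting off the first letter, the cross term vanishes by `iid_first_moment`, so variances add.
-/
lemma iid_second_moment (hp : p ∈ stdSimplex ℝ Z) (g : Z → ℝ) (hg : ∑ a, p a * g a = 0) (n : ℕ) :
    ∑ z : Fin n → Z, (∏ t, p (z t)) * (∑ t, g (z t)) ^ 2 = n * ∑ a, p a * g a ^ 2 := by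
  induction n with
  | zero => simp
  | succ n ih =>
    rw [sum_fin_succ_fun]
    have : ∀ a : Z, ∑ z : Fin n → Z, (∏ t, p ((Fin.cons a z : Fin (n + 1) → Z) t)) *
        (∑ t, g ((Fin.cons a z : Fin (n + 1) → Z) t)) ^ 2 =
          p a * g a ^ 2 + p a * (n * ∑ b, p b * g b ^ 2) := by
      intro a
      simp only [Fin.prod_univ_succ, Fin.sum_univ_succ, Fin.cons_zero, Fin.cons_succ]
      calc _ = p a * g a ^ 2 * (∑ z : Fin n → Z, ∏ t, p (z t)) +
            2 * p a * g a * (∑ z : Fin n → Z, (∏ t, p (z t)) * ∑ t, g (z t)) +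
            p a * ∑ z : Fin n → Z, (∏ t, p (z t)) * (∑ t, g (z t)) ^ 2 := by
              rw [Finset.mul_sum, Finset.mul_sum, Finset.mul_sum, ← Finset.sum_add_distrib,
                ← Finset.sum_add_distrib]
              exact Finset.sum_congr rfl fun z _ => by ring
        _ = _ := by rw [ih, iid_first_moment hp g hg, sum_prod_law_eq_one hp]; ring
    rw [Finset.sum_congr rfl fun a _ => this a, Finset.sum_add_distrib, ← Finset.sum_mul, hp.2]
    push_cast
    ring

lemma iidProb_nonneg (hp : p ∈ stdSimplex ℝ Z) {n : ℕ} (E : Set (Fin n → Z)) :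
    0 ≤ iidProb p n E :=
  Finset.sum_nonneg fun z _ => Set.indicator_nonneg (fun z _ => prod_law_nonneg hp z) z

lemma iidProb_compl (hp : p ∈ stdSimplex ℝ Z) {n : ℕ} (E : Set (Fin n → Z)) :
    iidProb p n Eᶜ = 1 - iidProb p n E := by
  rw [eq_sub_iff_add_eq, iidProb, iidProb, ← Finset.sum_add_distrib, ← sum_prod_law_eq_one hp n]
  refine Finset.sum_congr rfl fun z _ => ?_
  by_cases hz : z ∈ E <;> simp [hz]

/-- Monotonicity, where only words of positive probability count. -/
lemma iidProb_mono (hp : p ∈ stdSimplex ℝ Z) {n : ℕ} {E F : Set (Fin n → Z)}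
    (h : ∀ z ∈ E, (∀ t, 0 < p (z t)) → z ∈ F) : iidProb p n E ≤ iidProb p n F := by
  refine Finset.sum_le_sum fun z _ => ?_
  by_cases hz : z ∈ E
  · by_cases hpos : ∀ t, 0 < p (z t)
    · simp [hz, h z hz hpos]
    · push Not at hpos
      obtain ⟨t, ht⟩ := hpos
      have h0 : ∏ t, p (z t) = 0 :=
        Finset.prod_eq_zero (Finset.mem_univ t) (le_antisymm ht (hp.1 _))
      by_cases hF : z ∈ F <;> simp [hz, hF, h0]
  · rw [Set.indicator_of_notMem hz]
    exact Set.indicator_nonneg (fun z _ => prod_law_nonneg hp z) z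

lemma iidProb_union_le (hp : p ∈ stdSimplex ℝ Z) {n : ℕ} (E F : Set (Fin n → Z)) :
    iidProb p n (E ∪ F) ≤ iidProb p n E + iidProb p n F := by
  rw [iidProb, iidProb, iidProb, ← Finset.sum_add_distrib]
  refine Finset.sum_le_sum fun z _ => ?_
  have := prod_law_nonneg hp z
  by_cases hE : z ∈ E <;> by_cases hF : z ∈ F <;> simp [hE, hF, this]

lemma iidProb_iUnion_le (hp : p ∈ stdSimplex ℝ Z) {ι : Type*} [Fintype ι] {n : ℕ}
    (E : ι → Set (Fin n → Z)) : iidProb p n (⋃ i, E i) ≤ ∑ i, iidProb p n (E i) := by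
  simp only [iidProb]
  rw [Finset.sum_comm]
  refine Finset.sum_le_sum fun z _ => ?_
  have h0 : ∀ i, 0 ≤ (E i).indicator (fun z => ∏ t, p (z t)) z := fun i =>
    Set.indicator_nonneg (fun z _ => prod_law_nonneg hp z) z
  by_cases hz : z ∈ ⋃ i, E i
  · obtain ⟨i, hi⟩ := Set.mem_iUnion.1 hz
    rw [Set.indicator_of_mem hz]
    refine le_trans ?_ (Finset.single_le_sum (fun i _ => h0 i) (Finset.mem_univ i))
    rw [Set.indicator_of_mem hi]
  · rw [Set.indicator_of_notMem hz]
    exact Finset.sum_nonneg fun i _ => h0 i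

/-- The words whose empirical mean of `f` is not within `η` of the mean under `p`. -/
def deviationSet (p : Z → ℝ) (f : Z → ℝ) (η : ℝ) (n : ℕ) : Set (Fin n → Z) :=
  {z | n * η < |∑ t, f (z t) - n * ∑ a, p a * f a|}

/-- Chebyshev's inequality: on the deviation set the squared centred sum exceeds `(n * η) ^ 2`,
while its mean is `n` times the variance of one letter. -/
lemma iidProb_deviationSet_le (hp : p ∈ stdSimplex ℝ Z) (f : Z → ℝ) {η : ℝ} (hη : 0 < η)
    {n : ℕ} (hn : 0 < n) :
    iidProb p n (deviationSet p f η n) ≤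
      (∑ a, p a * (f a - ∑ b, p b * f b) ^ 2) / η ^ 2 / n := by
  set μ := ∑ b, p b * f b with hμ
  have hg : ∑ a, p a * (f a - μ) = 0 := by
    simp only [mul_sub, Finset.sum_sub_distrib, ← Finset.sum_mul, hp.2]
    rw [← hμ]; ring
  have h2 := iid_second_moment hp (fun a => f a - μ) hg n
  have hn' : (0 : ℝ) < n := by exact_mod_cast hn
  rw [le_div_iff₀ hn', le_div_iff₀ (by positivity)]
  refine le_of_mul_le_mul_left ?_ hn'
  rw [← h2]
  calc (n : ℝ) * (iidProb p n (deviationSet p f η n) * n * η ^ 2)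
      = ∑ z, (deviationSet p f η n).indicator (fun z => ∏ t, p (z t)) z * (n * η) ^ 2 := by
        rw [← Finset.sum_mul, iidProb]; ring
    _ ≤ _ := by
        refine Finset.sum_le_sum fun z _ => ?_
        by_cases hz : z ∈ deviationSet p f η n
        · rw [Set.indicator_of_mem hz]
          refine mul_le_mul_of_nonneg_left ?_ (prod_law_nonneg hp z)
          have hz' : n * η < |∑ t, f (z t) - n * μ| := hz
          have : ∑ t, (f (z t) - μ) = ∑ t, f (z t) - n * μ := by
            simp [Finset.sum_sub_distrib]
          rw [this, ← sq_abs (_ - _)]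
          exact pow_le_pow_left₀ (by positivity) hz'.le 2
        · rw [Set.indicator_of_notMem hz, zero_mul]
          exact mul_nonneg (prod_law_nonneg hp z) (sq_nonneg _)

/-- The weak law of large numbers on a finite alphabet. -/
lemma tendsto_iidProb_deviationSet (hp : p ∈ stdSimplex ℝ Z) (f : Z → ℝ) {η : ℝ} (hη : 0 < η) :
    Tendsto (fun n => iidProb p n (deviationSet p f η n)) atTop (𝓝 0) := by
  refine tendsto_of_tendsto_of_tendsto_of_le_of_le' tendsto_const_nhds
    (tendsto_const_div_atTop_nhds_zero_nat
      ((∑ a, p a * (f a - ∑ b, p b * f b) ^ 2) / η ^ 2))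
    (Eventually.of_forall fun n => iidProb_nonneg hp _) ?_
  filter_upwards [eventually_gt_atTop 0] with n hn
  exact iidProb_deviationSet_le hp f hη hn

/-- Words over an alphabet `Z` whose letterwise image is not typical for the image law have
vanishing probability. -/
lemma tendsto_iidProb_image_not_typical (hp : p ∈ stdSimplex ℝ Z) {F : Type*} [Fintype F]
    [DecidableEq F] (φ : Z → F) (Q : F → ℝ)
    (hQ : ∀ a, Q a = ∑ z, p z * (if φ z = a then 1 else 0)) {ε : ℝ} (hε : 0 < ε) :
    Tendsto (fun n => iidProb p n {z | (fun t => φ (z t)) ∉ typicalSet Q ε n}) atTop (𝓝 0) := by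
  have hlim : Tendsto (fun n => ∑ a : F,
      iidProb p n (deviationSet p (fun z => if φ z = a then 1 else 0) ε n)) atTop (𝓝 0) := by
    have := tendsto_finsetSum (Finset.univ : Finset F) fun a _ =>
      tendsto_iidProb_deviationSet hp (fun z => if φ z = a then 1 else 0) hε
    simpa using this
  refine squeeze_zero (fun n => iidProb_nonneg hp _) (fun n => ?_) hlim
  refine le_trans (iidProb_mono hp ?_) (iidProb_iUnion_le hp _)
  intro z hz hpos
  by_contra hcon
  refine hz fun a => ⟨?_, fun h0 t ht => ?_⟩
  · by_contra hlt
    refine hcon (Set.mem_iUnion.2 ⟨a, ?_⟩)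
    rw [not_le] at hlt
    simp only [deviationSet, Set.mem_ofPred_eq, ← hQ a, Finset.sum_boole]
    exact hlt
  -- A letter of image probability zero has only preimages of probability zero, and words containing
  -- those carry no mass.
  · rw [hQ] at h0
    have hnn : ∀ z ∈ (Finset.univ : Finset Z), 0 ≤ p z * (if φ z = a then (1 : ℝ) else 0) :=
      fun z _ => mul_nonneg (hp.1 z) (by split_ifs <;> norm_num)
    have := (Finset.sum_eq_zero_iff_of_nonneg hnn).1 h0 (z t) (Finset.mem_univ _)
    simp only [ht, if_true, mul_one] at this
    exact (hpos t).ne' this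

/-- Words of probability at least `r` number at most `1 / r`. -/
lemma card_mul_le_one_of_le_prod (hp : p ∈ stdSimplex ℝ Z) {n : ℕ} (S : Finset (Fin n → Z)) {r : ℝ}
    (h : ∀ z ∈ S, r ≤ ∏ t, p (z t)) : (S.card : ℝ) * r ≤ 1 := by
  rw [← sum_prod_law_eq_one hp n, ← nsmul_eq_mul]
  refine (Finset.card_nsmul_le_sum S _ r h).trans ?_
  exact Finset.sum_le_sum_of_subset_of_nonneg (Finset.subset_univ _)
    fun z _ _ => prod_law_nonneg hp z

/-- Entropy, in bits, of the law `p`. -/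
def entropyBits (p : Z → ℝ) : ℝ := -∑ a, p a * Real.logb 2 (p a)

/-- The log-probability of a word is the sum of `logb 2 (p a)` weighted by letter counts, and
typicality moves each count by at most `n * ε` from `n * p a`. Letters of probability zero are
absent, so every logarithm that matters is that of a positive number. -/
lemma two_rpow_le_prod_of_typical [DecidableEq Z] (hp : p ∈ stdSimplex ℝ Z) {ε : ℝ} {n : ℕ}
    {z : Fin n → Z} (hz : z ∈ typicalSet p ε n) :
    (2 : ℝ) ^ (-(n * (entropyBits p + ε * ∑ a, |Real.logb 2 (p a)|))) ≤ ∏ t, p (z t) := by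
  have hpos : ∀ t, 0 < p (z t) := fun t =>
    lt_of_le_of_ne (hp.1 _) fun h => (hz (z t)).2 h.symm t rfl
  have hprod : 0 < ∏ t, p (z t) := Finset.prod_pos fun t _ => hpos t
  rw [← Real.le_logb_iff_rpow_le (by norm_num) hprod,
    Real.logb_prod _ _ fun t _ => (hpos t).ne']
  have hsum : ∑ t, Real.logb 2 (p (z t)) =
      ∑ a, ((Finset.univ.filter fun t => z t = a).card : ℝ) * Real.logb 2 (p a) := by
    rw [← Finset.sum_fiberwise (s := Finset.univ) (g := z)]
    refine Finset.sum_congr rfl fun a _ => ?_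
    rw [← nsmul_eq_mul, ← Finset.sum_const]
    refine Finset.sum_congr rfl fun t ht => ?_
    rw [(Finset.mem_filter.1 ht).2]
  rw [hsum]
  have key : ∀ a, n * (p a * Real.logb 2 (p a)) - n * ε * |Real.logb 2 (p a)| ≤
      ((Finset.univ.filter fun t => z t = a).card : ℝ) * Real.logb 2 (p a) := by
    intro a
    have h1 := mul_le_mul_of_nonneg_right (hz a).1 (abs_nonneg (Real.logb 2 (p a)))
    rw [← abs_mul] at h1
    have h2 := (abs_le.1 h1).1
    linarith
  refine le_trans (le_of_eq ?_) (Finset.sum_le_sum fun a _ => key a)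
  rw [Finset.sum_sub_distrib, ← Finset.mul_sum, ← Finset.mul_sum, entropyBits]
  ring

lemma card_typicalSet_le [DecidableEq Z] (hp : p ∈ stdSimplex ℝ Z) {ε : ℝ} {n : ℕ}
    (S : Finset (Fin n → Z)) (hS : ∀ z ∈ S, z ∈ typicalSet p ε n) :
    (S.card : ℝ) ≤ 2 ^ (n * (entropyBits p + ε * ∑ a, |Real.logb 2 (p a)|)) := by
  have h := card_mul_le_one_of_le_prod hp S fun z hz => two_rpow_le_prod_of_typical hp (hS z hz)
  rwa [Real.rpow_neg (by norm_num), ← div_eq_mul_inv, div_le_one (by positivity)] at h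

end IID

/-! ### Uniform typicality and Gibbs' inequality -/

/-- A large part of all words is typical for the uniform law. -/
lemma eventually_card_typicalSet_uniform {F : Type*} [Fintype F] [DecidableEq F] [Nonempty F]
    {ε : ℝ} (hε : 0 < ε) :
    ∀ᶠ k in atTop, (Fintype.card F : ℝ) ^ k / 2 ≤
      ((typicalSet (fun _ : F => (Fintype.card F : ℝ)⁻¹) ε k).ncard : ℝ) := by
  classical
  set N : ℝ := (Fintype.card F : ℝ) with hN
  have hN0 : 0 < N := by rw [hN]; exact_mod_cast Fintype.card_pos
  have hp : (fun _ : F => N⁻¹) ∈ stdSimplex ℝ F :=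
    ⟨fun _ => by positivity, by simp [← hN, hN0.ne']⟩
  have h := tendsto_iidProb_image_not_typical hp id (fun _ => N⁻¹) (by simp) hε
  filter_upwards [h.eventually_lt_const (by norm_num : (0 : ℝ) < 1 / 2)] with k hk
  have hk' : iidProb (fun _ : F => N⁻¹) k (typicalSet (fun _ : F => N⁻¹) ε k)ᶜ < 1 / 2 := hk
  rw [iidProb_compl hp] at hk'
  have hcard : iidProb (fun _ : F => N⁻¹) k (typicalSet (fun _ : F => N⁻¹) ε k) =
      ((typicalSet (fun _ : F => N⁻¹) ε k).ncard : ℝ) / N ^ k := by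
    rw [iidProb, Set.ncard_eq_toFinset_card']
    simp only [Set.indicator_apply, Finset.prod_const, Finset.card_univ, Fintype.card_fin]
    rw [← Finset.sum_filter, Finset.sum_const, nsmul_eq_mul, inv_pow, div_eq_mul_inv]
    congr 3
    ext; simp
  rw [hcard] at hk'
  have : (1 : ℝ) / 2 < ((typicalSet (fun _ : F => N⁻¹) ε k).ncard : ℝ) / N ^ k := by linarith
  rw [lt_div_iff₀ (by positivity)] at this
  linarith

/-- Gibbs' inequality for a channel and a fixed law on its output alphabet. -/
lemma sum_mul_logb_div_nonneg {A F : Type*} [Fintype A] [Fintype F] {P : A → ℝ}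
    (hP : P ∈ stdSimplex ℝ A) {W : A → F → ℝ} (hW : ∀ x, W x ∈ stdSimplex ℝ F) {r : F → ℝ}
    (hr : r ∈ stdSimplex ℝ F) (hac : ∀ x y, 0 < P x → 0 < W x y → 0 < r y) :
    0 ≤ ∑ x, ∑ y, P x * W x y * Real.logb 2 (W x y / r y) := by
  have hlog : 0 < Real.log 2 := Real.log_pos (by norm_num)
  -- This is `log t ≥ 1 - 1 / t`; the lower bounds sum to zero because `W x` and `r` have the same
  -- total mass.
  have key : ∀ x y, (P x * W x y - P x * r y) / Real.log 2 ≤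
      P x * W x y * Real.logb 2 (W x y / r y) := by
    intro x y
    rcases (hP.1 x).eq_or_lt with h | hx
    · simp [← h]
    rcases ((hW x).1 y).eq_or_lt with h | hy
    · rw [← h]
      simp only [mul_zero, zero_mul, zero_sub]
      exact div_nonpos_of_nonpos_of_nonneg (neg_nonpos.2 (mul_nonneg hx.le (hr.1 y))) hlog.le
    have hry := hac x y hx hy
    rw [Real.logb, ← mul_div_assoc]
    refine div_le_div_of_nonneg_right ?_ hlog.le
    have h1 := Real.one_sub_inv_le_log_of_pos (div_pos hy hry)
    refine le_trans (le_of_eq ?_) (mul_le_mul_of_nonneg_left h1 (mul_pos hx hy).le)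
    field_simp
  refine le_trans (le_of_eq ?_) (Finset.sum_le_sum fun x _ => Finset.sum_le_sum fun y _ => key x y)
  simp only [← Finset.sum_div, Finset.sum_sub_distrib, ← Finset.mul_sum, hr.2]
  simp [(hW _).2]

/-! ### Covering and binning with pairwise independent words -/

section Counting

open Classical in
/-- The family of random words `word · u`, with `ω` uniform on `Ω`, is pairwise independent, and
every one of its members is uniform on `Y`. -/
structure PairwiseUniform {Ω ι Y : Type*} [Fintype Ω] [Fintype Y] (word : Ω → ι → Y) : Prop where
  card_eq : ∀ u y, ((Finset.univ.filter fun ω => word ω u = y).card : ℝ) * Fintype.card Y =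
    Fintype.card Ω
  card_pair_eq : ∀ u u', u ≠ u' → ∀ y y',
    ((Finset.univ.filter fun ω => word ω u = y ∧ word ω u' = y').card : ℝ) *
      (Fintype.card Y : ℝ) ^ 2 = Fintype.card Ω

variable {Ω ι Y : Type*} [Fintype Ω] [Fintype Y] {word : Ω → ι → Y}

open Classical in
lemma PairwiseUniform.card_mem (h : PairwiseUniform word) (u : ι) (J : Finset Y) :
    ((Finset.univ.filter fun ω => word ω u ∈ J).card : ℝ) * Fintype.card Y =
      J.card * Fintype.card Ω := by
  rw [Finset.card_eq_sum_card_fiberwise (f := fun ω => word ω u) (t := J)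
    (fun ω hω => by simpa using hω)]
  push_cast
  rw [Finset.sum_mul, ← nsmul_eq_mul, ← Finset.sum_const]
  refine Finset.sum_congr rfl fun y hy => ?_
  rw [← h.card_eq u y, Finset.filter_filter]
  congr 3
  ext ω
  simp only [Finset.mem_filter, Finset.mem_univ, true_and]
  constructor
  · exact fun h => h.2
  · rintro rfl
    exact ⟨hy, rfl⟩

open Classical in
lemma PairwiseUniform.card_pair_mem (h : PairwiseUniform word) {u u' : ι} (hu : u ≠ u')
    (J : Finset Y) :
    ((Finset.univ.filter fun ω => word ω u ∈ J ∧ word ω u' ∈ J).card : ℝ) *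
      (Fintype.card Y : ℝ) ^ 2 = (J.card : ℝ) ^ 2 * Fintype.card Ω := by
  rw [Finset.card_eq_sum_card_fiberwise (f := fun ω => (word ω u, word ω u')) (t := J ×ˢ J)
    (fun ω hω => by simpa using hω)]
  push_cast
  rw [Finset.sum_mul, sq (J.card : ℝ), ← Nat.cast_mul, ← Finset.card_product, ← nsmul_eq_mul,
    ← Finset.sum_const]
  refine Finset.sum_congr rfl fun y hy => ?_
  rw [← h.card_pair_eq u u' hu y.1 y.2, Finset.filter_filter]
  congr 3
  ext ω
  rw [Finset.mem_product] at hy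
  simp only [Finset.mem_filter, Finset.mem_univ, true_and]
  constructor
  · rintro ⟨-, h⟩
    rw [← h]
    exact ⟨rfl, rfl⟩
  · rintro ⟨h1, h2⟩
    rw [h1, h2]
    exact ⟨hy, rfl⟩

open Classical in
/-- Second moment method: a target set `J` is missed by all words indexed by `T` for at most the
fraction `|Y| / (|T| |J|)` of all `ω`. -/
lemma PairwiseUniform.card_miss_le (h : PairwiseUniform word) [Nonempty Y] (T : Finset ι)
    (J : Finset Y) (hT : T.Nonempty) (hJ : J.Nonempty) :
    ((Finset.univ.filter fun ω => ∀ u ∈ T, word ω u ∉ J).card : ℝ) ≤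
      Fintype.card Ω * (Fintype.card Y / (T.card * J.card)) := by
  have hY : (0 : ℝ) < Fintype.card Y := by exact_mod_cast Fintype.card_pos
  have hT' : (0 : ℝ) < T.card := by exact_mod_cast hT.card_pos
  have hJ' : (0 : ℝ) < J.card := by exact_mod_cast hJ.card_pos
  set N : ℝ := (Fintype.card Ω : ℝ) with hN
  have hN0 : 0 ≤ N := by positivity
  set ρ : ℝ := (J.card : ℝ) / (Fintype.card Y : ℝ) with hρ
  have hρ0 : 0 < ρ := by positivity
  set X : Ω → ι → ℝ := fun ω u => if word ω u ∈ J then 1 else 0 with hX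
  have h1 : ∀ u, ∑ ω, X ω u = N * ρ := by
    intro u
    simp only [hX, Finset.sum_boole]
    rw [hρ, mul_div_assoc', eq_div_iff hY.ne', h.card_mem, mul_comm]
  have h2 : ∀ u u', u ≠ u' → ∑ ω, X ω u * X ω u' = N * ρ ^ 2 := by
    intro u u' hu
    have : ∀ ω, X ω u * X ω u' = if word ω u ∈ J ∧ word ω u' ∈ J then (1 : ℝ) else 0 := by
      intro ω
      by_cases ha : word ω u ∈ J <;> by_cases hb : word ω u' ∈ J <;> simp [hX, ha, hb]
    simp only [this, Finset.sum_boole]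
    rw [hρ, div_pow, mul_div_assoc', eq_div_iff (by positivity), h.card_pair_mem hu, mul_comm]
  -- The diagonal escapes pairwise independence, but there the indicator equals its square and the
  -- first moment suffices.
  have h3 : ∀ u u', ∑ ω, X ω u * X ω u' ≤ N * ρ ^ 2 + if u = u' then N * ρ else 0 := by
    intro u u'
    by_cases hu : u = u'
    · subst hu
      have : ∀ ω, X ω u * X ω u = X ω u := fun ω => by simp [hX]
      simp only [this, h1, if_true]
      nlinarith [mul_nonneg hN0 (sq_nonneg ρ)]
    · simp [hu, h2 u u' hu]
  set μ : ℝ := T.card * ρ with hμ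
  have hμ0 : 0 < μ := by positivity
  have hfirst : ∑ ω, ∑ u ∈ T, X ω u = N * μ := by
    rw [Finset.sum_comm, Finset.sum_congr rfl fun u _ => h1 u, Finset.sum_const, nsmul_eq_mul]
    ring
  have hsecond : ∑ ω, (∑ u ∈ T, X ω u) ^ 2 ≤ N * μ ^ 2 + N * μ := by
    calc ∑ ω, (∑ u ∈ T, X ω u) ^ 2 = ∑ u ∈ T, ∑ u' ∈ T, ∑ ω, X ω u * X ω u' := by
          simp only [sq, Finset.sum_mul_sum]
          rw [Finset.sum_comm]
          exact Finset.sum_congr rfl fun u _ => Finset.sum_comm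
      _ ≤ ∑ u ∈ T, ∑ u' ∈ T, (N * ρ ^ 2 + if u = u' then N * ρ else 0) :=
          Finset.sum_le_sum fun u _ => Finset.sum_le_sum fun u' _ => h3 u u'
      _ = N * μ ^ 2 + N * μ := by
          simp only [Finset.sum_add_distrib, Finset.sum_const, Finset.sum_ite_eq, nsmul_eq_mul]
          rw [Finset.sum_ite_mem, Finset.inter_self, Finset.sum_const, nsmul_eq_mul]
          ring
  have hvar : ∑ ω, (∑ u ∈ T, X ω u - μ) ^ 2 ≤ N * μ := by
    have : ∑ ω, (∑ u ∈ T, X ω u - μ) ^ 2 =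
        ∑ ω, (∑ u ∈ T, X ω u) ^ 2 - 2 * μ * ∑ ω, (∑ u ∈ T, X ω u) + N * μ ^ 2 := by
      rw [Finset.mul_sum, ← Finset.sum_sub_distrib, hN, ← nsmul_eq_mul, ← Finset.card_univ,
        ← Finset.sum_const, ← Finset.sum_add_distrib]
      exact Finset.sum_congr rfl fun ω _ => by ring
    rw [this, hfirst]
    nlinarith
  set Z := Finset.univ.filter fun ω => ∀ u ∈ T, word ω u ∉ J with hZ
  -- Chebyshev: a draw that misses `J` has hit count zero, hence deviation exactly `μ`.
  have hlow : (Z.card : ℝ) * μ ^ 2 ≤ ∑ ω, (∑ u ∈ T, X ω u - μ) ^ 2 := by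
    rw [← nsmul_eq_mul]
    refine (Finset.card_nsmul_le_sum Z _ _ fun ω hω => ?_).trans
      (Finset.sum_le_sum_of_subset_of_nonneg (Finset.subset_univ Z) fun ω _ _ => sq_nonneg _)
    have : ∑ u ∈ T, X ω u = 0 :=
      Finset.sum_eq_zero fun u hu => by simp [hX, (Finset.mem_filter.1 hω).2 u hu]
    rw [this]
    apply le_of_eq
    ring
  have hfin : (Z.card : ℝ) * μ ≤ N := by
    refine le_of_mul_le_mul_right ?_ hμ0
    nlinarith
  have : (Fintype.card Y : ℝ) / (T.card * J.card) = μ⁻¹ := by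
    rw [hμ, hρ]
    field_simp
  rw [this, ← div_eq_mul_inv, le_div_iff₀ hμ0]
  exact hfin

open Classical in
/-- Two different words share a bin for the fraction `1 / M` of all binnings. -/
lemma card_bin_eq_mul_le {M : ℕ} {c c' : Y} (hc : c ≠ c') :
    (Finset.univ.filter fun bin : Y → Fin M => bin c' = bin c).card * M ≤
      Fintype.card (Y → Fin M) := by
  have : (Finset.univ.filter fun bin : Y → Fin M => bin c' = bin c).card * M =
      ((Finset.univ.filter fun bin : Y → Fin M => bin c' = bin c) ×ˢ
        (Finset.univ : Finset (Fin M))).card := by simp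
  rw [this, ← Finset.card_univ]
  -- Overwriting the bin of `c` loses nothing: its old value is still visible as the bin of `c'`.
  refine Finset.card_le_card_of_injOn (fun b => Function.update b.1 c b.2)
    (fun _ _ => by simp) ?_
  rintro ⟨b, s⟩ hb ⟨b', s'⟩ hb' heq
  simp only [Finset.coe_product, Set.mem_prod, Finset.mem_coe, Finset.mem_filter,
    Finset.mem_univ, true_and] at hb hb'
  have hval : ∀ y, Function.update b c s y = Function.update b' c s' y := fun y => congrFun heq y
  have hne : ∀ y, y ≠ c → b y = b' y := fun y hy => by simpa [hy] using hval y
  have hs : s = s' := by simpa using hval c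
  refine Prod.ext (funext fun y => ?_) hs
  by_cases hy : y = c
  · change b y = b' y
    rw [hy, ← hb.1, ← hb'.1]
    exact hne c' hc.symm
  · exact hne y hy

open Classical in
lemma card_collision_mul_le {M : ℕ} (S : Finset Y) (c : Y) :
    (Finset.univ.filter fun bin : Y → Fin M =>
      ∃ c' ∈ S, c' ≠ c ∧ bin c' = bin c).card * M ≤ S.card * Fintype.card (Y → Fin M) := by
  have hsub : (Finset.univ.filter fun bin : Y → Fin M => ∃ c' ∈ S, c' ≠ c ∧ bin c' = bin c) ⊆
      (S.filter (· ≠ c)).biUnion fun c' =>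
        Finset.univ.filter fun bin : Y → Fin M => bin c' = bin c := by
    intro bin hbin
    obtain ⟨-, c', hc', hne, heq⟩ := Finset.mem_filter.1 hbin
    exact Finset.mem_biUnion.2 ⟨c', Finset.mem_filter.2 ⟨hc', hne⟩, by simpa using heq⟩
  calc _ ≤ (∑ c' ∈ S.filter (· ≠ c),
        (Finset.univ.filter fun bin : Y → Fin M => bin c' = bin c).card) * M :=
        Nat.mul_le_mul_right _ ((Finset.card_le_card hsub).trans Finset.card_biUnion_le)
    _ ≤ ∑ c' ∈ S.filter (· ≠ c), Fintype.card (Y → Fin M) := by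
        rw [Finset.sum_mul]
        exact Finset.sum_le_sum fun c' hc' =>
          card_bin_eq_mul_le (Finset.mem_filter.1 hc').2.symm
    _ ≤ _ := by
        rw [Finset.sum_const, smul_eq_mul]
        exact Nat.mul_le_mul_right _ (Finset.card_filter_le _ _)

/-- The code draw `ω` and the binning `bin` serve the target set `J`: some word indexed by `T` lies
in `J`, and no other word indexed by `T` that lies in `S` shares its bin. -/
def Served {M : ℕ} (word : Ω → ι → Y) (T : Finset ι) (S J : Finset Y) (w : Ω × (Y → Fin M)) :
    Prop :=
  ∃ u ∈ T, word w.1 u ∈ J ∧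
    ∀ u' ∈ T, word w.1 u' ∈ S → w.2 (word w.1 u') = w.2 (word w.1 u) →
      word w.1 u' = word w.1 u

/-- The first term is the miss probability. For the second, fix a code draw that hits `J`: a
collision has probability at most `1 / M` times the number of indices in `T` whose words lie in `S`,
and this number has mean `|T| |S| / |Y|`. -/
lemma PairwiseUniform.ncard_not_served_le (h : PairwiseUniform word) [Nonempty Y] {M : ℕ}
    (hM : 0 < M) (T : Finset ι) (S J : Finset Y) (hT : T.Nonempty) (hJ : J.Nonempty) :
    ({w : Ω × (Y → Fin M) | ¬ Served word T S J w}.ncard : ℝ) ≤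
      Nat.card (Ω × (Y → Fin M)) *
        (Fintype.card Y / (T.card * J.card) + T.card * S.card / (Fintype.card Y * M)) := by
  classical
  rw [Set.ncard_eq_toFinset_card', Nat.card_eq_fintype_card, Set.toFinset_ofPred]
  have hY : (0 : ℝ) < Fintype.card Y := by exact_mod_cast Fintype.card_pos
  have hM' : (0 : ℝ) < M := by exact_mod_cast hM
  set B : ℝ := (Fintype.card (Y → Fin M) : ℝ) with hB
  have hB0 : 0 ≤ B := by positivity
  have hfib : ((Finset.univ.filter fun w : Ω × (Y → Fin M) => ¬ Served word T S J w).card : ℝ) =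
      ∑ ω, ((Finset.univ.filter fun bin : Y → Fin M => ¬ Served word T S J (ω, bin)).card : ℝ) := by
    simp only [Finset.card_filter]
    push_cast
    rw [Fintype.sum_prod_type]
  have hpt : ∀ ω,
      ((Finset.univ.filter fun bin : Y → Fin M => ¬ Served word T S J (ω, bin)).card : ℝ) ≤
        (if ∀ u ∈ T, word ω u ∉ J then 1 else 0) * B +
          (∑ u ∈ T, if word ω u ∈ S then (1 : ℝ) else 0) * (B / M) := by
    intro ω
    have hsum0 : 0 ≤ (∑ u ∈ T, if word ω u ∈ S then (1 : ℝ) else 0) :=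
      Finset.sum_nonneg fun u _ => by split_ifs <;> norm_num
    by_cases hmiss : ∀ u ∈ T, word ω u ∉ J
    · rw [if_pos hmiss, one_mul]
      refine le_add_of_le_of_nonneg ?_ (by positivity)
      rw [hB]
      exact_mod_cast Finset.card_le_univ
        (Finset.univ.filter fun bin : Y → Fin M => ¬ Served word T S J (ω, bin))
    · rw [if_neg hmiss, zero_mul, zero_add]
      push Not at hmiss
      obtain ⟨u, hu, huJ⟩ := hmiss
      -- The word `word ω u` is chosen before the binning. Passing to the image counts a word with
      -- several indices once, so repetitions are not collisions.
      set S' := (T.filter fun u' => word ω u' ∈ S).image (word ω) with hS'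
      have hcol := card_collision_mul_le (M := M) S' (word ω u)
      have hsub : (Finset.univ.filter fun bin : Y → Fin M => ¬ Served word T S J (ω, bin)) ⊆
          Finset.univ.filter fun bin : Y → Fin M =>
            ∃ c' ∈ S', c' ≠ word ω u ∧ bin c' = bin (word ω u) := by
        intro bin hbin
        have hb := (Finset.mem_filter.1 hbin).2
        refine Finset.mem_filter.2 ⟨Finset.mem_univ _, ?_⟩
        by_contra hcon
        refine hb ⟨u, hu, huJ, fun u' hu' hS hbe => ?_⟩
        by_contra hne
        exact hcon ⟨word ω u', Finset.mem_image_of_mem _ (Finset.mem_filter.2 ⟨hu', hS⟩), hne, hbe⟩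
      have hc1 := Finset.card_le_card hsub
      have hc2 : S'.card ≤ (T.filter fun u' => word ω u' ∈ S).card := Finset.card_image_le
      rw [Finset.sum_boole, mul_div_assoc', le_div_iff₀ hM']
      have : (Finset.univ.filter fun bin : Y → Fin M => ¬ Served word T S J (ω, bin)).card * M ≤
          (T.filter fun u' => word ω u' ∈ S).card * Fintype.card (Y → Fin M) :=
        (Nat.mul_le_mul_right _ hc1).trans (hcol.trans (Nat.mul_le_mul_right _ hc2))
      rw [hB]
      exact_mod_cast this
  rw [hfib]
  refine (Finset.sum_le_sum fun ω _ => hpt ω).trans ?_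
  rw [Finset.sum_add_distrib, ← Finset.sum_mul, ← Finset.sum_mul, Finset.sum_boole,
    Finset.sum_comm]
  have hS : ∑ u ∈ T, ∑ ω, (if word ω u ∈ S then (1 : ℝ) else 0) =
      T.card * (S.card * Fintype.card Ω / Fintype.card Y) := by
    rw [← nsmul_eq_mul, ← Finset.sum_const]
    refine Finset.sum_congr rfl fun u _ => ?_
    rw [Finset.sum_boole, eq_div_iff hY.ne', h.card_mem]
  rw [hS, Fintype.card_prod, Nat.cast_mul, mul_add]
  refine add_le_add ?_ (le_of_eq ?_)
  · rw [mul_right_comm]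
    exact mul_le_mul_of_nonneg_right (h.card_miss_le T J hT hJ) hB0
  · rw [← hB]
    field_simp

end Counting

/-! ### Pairwise independence in dithered linear codes -/

section LinearWords

/-- In a finite additive group, the fibres of a surjective homomorphism have equal cardinality. -/
lemma card_fiber_mul_card {G H : Type*} [AddGroup G] [AddGroup H] [Fintype G] [Fintype H]
    [DecidableEq H] (f : G →+ H) (hf : Function.Surjective f) (y : H) :
    (Finset.univ.filter fun g => f g = y).card * Fintype.card H = Fintype.card G := by
  rw [← Finset.card_univ (α := G), Finset.card_eq_sum_card_fiberwise (s := Finset.univ) (f := f)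
      (t := Finset.univ) (fun _ _ => by simp),
    Finset.sum_congr rfl fun z _ => AddMonoidHom.card_fiber_eq_of_mem_range f (hf z) (hf y)]
  simp [mul_comm]

variable {q l m n : ℕ} {k : Fin m → ℕ}

/-- The word with index `u` of the `j`-th code. -/
def nqlcWord (j : Fin l)
    (w : ((i : Fin m) → Matrix (Fin (k i)) (Fin n) (ZMod q)) × (Fin l → Fin n → ZMod q))
    (u : (i : Fin m) → Fin (k i) → ZMod q) : Fin n → ZMod q :=
  (∑ i, Matrix.vecMul (u i) (w.1 i)) + w.2 j

/-- Words depend additively on matrices and dithers, so it is enough that the maps to one word and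
to a pair of words are onto: fibres then have equal size. The dither alone reaches any single word.
Two indices differ in some coordinate, and the difference is invertible in the field. -/
lemma pairwiseUniform_nqlcWord [Fact q.Prime] (j : Fin l) :
    PairwiseUniform (nqlcWord (q := q) (m := m) (n := n) (k := k) j) := by
  classical
  have hsur1 : ∀ u, Function.Surjective fun w => nqlcWord (q := q) (n := n) (k := k) j w u :=
    fun u v => ⟨(0, fun _ => v), by simp [nqlcWord]⟩
  constructor
  · intro u y
    let f : (((i : Fin m) → Matrix (Fin (k i)) (Fin n) (ZMod q)) × (Fin l → Fin n → ZMod q)) →+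
        (Fin n → ZMod q) :=
      { toFun := fun w => nqlcWord j w u
        map_zero' := by simp [nqlcWord]
        map_add' := fun a b => by
          simp only [nqlcWord, Prod.fst_add, Prod.snd_add, Pi.add_apply, Matrix.vecMul_add,
            Finset.sum_add_distrib]
          abel }
    have := card_fiber_mul_card f (hsur1 u) y
    rw [← Nat.cast_mul]
    congr 1
    rw [← this]
    congr
  · intro u u' hu y y'
    let f : (((i : Fin m) → Matrix (Fin (k i)) (Fin n) (ZMod q)) × (Fin l → Fin n → ZMod q)) →+
        (Fin n → ZMod q) × (Fin n → ZMod q) :=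
      { toFun := fun w => (nqlcWord j w u, nqlcWord j w u')
        map_zero' := by simp [nqlcWord]
        map_add' := fun a b => by
          simp only [nqlcWord, Prod.fst_add, Prod.snd_add, Pi.add_apply, Matrix.vecMul_add,
            Finset.sum_add_distrib]
          ext <;> simp only [Prod.fst_add, Prod.snd_add, Pi.add_apply] <;> ring }
    have hf : Function.Surjective f := by
      rintro ⟨v, v'⟩
      obtain ⟨i, hi⟩ := Function.ne_iff.1 hu
      obtain ⟨r, hr⟩ := Function.ne_iff.1 hi
      have hr' : u i r - u' i r ≠ 0 := sub_ne_zero.2 hr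
      -- One nonzero row, scaled so that the two words differ by `v - v'`; the dither below then
      -- shifts the first word to `v`.
      let G : (i : Fin m) → Matrix (Fin (k i)) (Fin n) (ZMod q) :=
        Pi.single i (Matrix.of fun r' t => if r' = r then (u i r - u' i r)⁻¹ * (v t - v' t) else 0)
      have hG : ∀ (a : (i : Fin m) → Fin (k i) → ZMod q) (t : Fin n),
          (∑ i, Matrix.vecMul (a i) (G i)) t =
            a i r * ((u i r - u' i r)⁻¹ * (v t - v' t)) := by
        intro a t
        rw [Finset.sum_eq_single i]
        · simp [G, Matrix.vecMul, dotProduct]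
        · intro i' _ hne
          simp [G, hne]
        · simp
      refine ⟨(G, fun _ t => v t - u i r * ((u i r - u' i r)⁻¹ * (v t - v' t))), ?_⟩
      refine Prod.ext (funext fun t => ?_) (funext fun t => ?_)
      · change (∑ i, Matrix.vecMul (u i) (G i)) t + _ = v t
        rw [hG]
        ring
      · change (∑ i, Matrix.vecMul (u' i) (G i)) t + _ = v' t
        rw [hG]
        have : (u i r - u' i r) * (u i r - u' i r)⁻¹ = 1 := mul_inv_cancel₀ hr'
        linear_combination (v' t - v t) * this
    have := card_fiber_mul_card f hf (y, y')
    rw [Fintype.card_prod, ← sq] at this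
    rw [← Nat.cast_pow, ← Nat.cast_mul]
    congr 1
    rw [← this]
    congr! 3
    simp [f]

end LinearWords

/-! ### Test channels and covering sets -/

lemma sum_prod_channel_eq_one {A F : Type*} [Fintype F] {W : A → F → ℝ}
    (hW : ∀ x, W x ∈ stdSimplex ℝ F) {n : ℕ} (x : Fin n → A) :
    ∑ y : Fin n → F, ∏ t, W (x t) (y t) = 1 := by
  classical
  have := Finset.prod_univ_sum (fun _ : Fin n => (Finset.univ : Finset F)) (fun t a => W (x t) a)
  simp only [Fintype.piFinset_univ] at this
  rw [← this]
  simp [(hW _).2]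

section TestChannel

variable {A F : Type*} [Fintype A] [Fintype F] {P : A → ℝ} {W : A → F → ℝ}

/-- The joint law of input and output of the channel `W` with input law `P`. -/
def jointLaw (P : A → ℝ) (W : A → F → ℝ) (z : A × F) : ℝ := P z.1 * W z.1 z.2

/-- Conditional entropy, in bits, of the output of the channel `W` given its input. -/
def condEntropyBits (P : A → ℝ) (W : A → F → ℝ) : ℝ :=
  -∑ x, ∑ y, P x * W x y * Real.logb 2 (W x y)

lemma jointLaw_mem_stdSimplex (hP : P ∈ stdSimplex ℝ A) (hW : ∀ x, W x ∈ stdSimplex ℝ F) :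
    jointLaw P W ∈ stdSimplex ℝ (A × F) := by
  refine ⟨fun z => mul_nonneg (hP.1 _) ((hW _).1 _), ?_⟩
  simp [jointLaw, Fintype.sum_prod_type, ← Finset.mul_sum, (hW _).2, hP.2]

lemma outputLaw_mem_stdSimplex (hP : P ∈ stdSimplex ℝ A) (hW : ∀ x, W x ∈ stdSimplex ℝ F) :
    outputLaw P W ∈ stdSimplex ℝ F := by
  refine ⟨fun y => Finset.sum_nonneg fun x _ => mul_nonneg (hP.1 _) ((hW _).1 _), ?_⟩
  simp only [outputLaw]
  rw [Finset.sum_comm]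
  simp [← Finset.mul_sum, (hW _).2, hP.2]

lemma outputLaw_pos (hP : P ∈ stdSimplex ℝ A) (hW : ∀ x, W x ∈ stdSimplex ℝ F) {x : A} {y : F}
    (hx : 0 < P x) (hy : 0 < W x y) : 0 < outputLaw P W y :=
  lt_of_lt_of_le (mul_pos hx hy) (Finset.single_le_sum (f := fun x => P x * W x y)
    (fun x _ => mul_nonneg (hP.1 x) ((hW x).1 y)) (Finset.mem_univ x))

lemma mutualInfo_nonneg (hP : P ∈ stdSimplex ℝ A) (hW : ∀ x, W x ∈ stdSimplex ℝ F) :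
    0 ≤ mutualInfo P W :=
  sum_mul_logb_div_nonneg hP hW (outputLaw_mem_stdSimplex hP hW) fun _ _ => outputLaw_pos hP hW

lemma mutualInfo_eq_entropyBits_sub (hP : P ∈ stdSimplex ℝ A) (hW : ∀ x, W x ∈ stdSimplex ℝ F) :
    mutualInfo P W = entropyBits (outputLaw P W) - condEntropyBits P W := by
  have h1 : ∀ x y, P x * W x y * Real.logb 2 (W x y / outputLaw P W y) =
      P x * W x y * Real.logb 2 (W x y) - P x * W x y * Real.logb 2 (outputLaw P W y) := by
    intro x y
    rcases (hP.1 x).eq_or_lt with h | hx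
    · simp [← h]
    rcases ((hW x).1 y).eq_or_lt with h | hy
    · simp [← h]
    rw [Real.logb_div hy.ne' (outputLaw_pos hP hW hx hy).ne', mul_sub]
  have h2 : ∑ x, ∑ y, P x * W x y * Real.logb 2 (outputLaw P W y) =
      ∑ y, outputLaw P W y * Real.logb 2 (outputLaw P W y) := by
    rw [Finset.sum_comm]
    exact Finset.sum_congr rfl fun y _ => (Finset.sum_mul _ _ _).symm
  simp only [mutualInfo, entropyBits, condEntropyBits, h1, Finset.sum_sub_distrib]
  rw [h2]
  ring

/-- Gibbs' inequality against the uniform law. It makes the exponent of the code size positive, so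
that the index length can grow. -/
lemma condEntropyBits_le_logb_card [Nonempty F] (hP : P ∈ stdSimplex ℝ A)
    (hW : ∀ x, W x ∈ stdSimplex ℝ F) : condEntropyBits P W ≤ Real.logb 2 (Fintype.card F) := by
  have hN : (0 : ℝ) < (Fintype.card F : ℝ) := by exact_mod_cast Fintype.card_pos
  have h := sum_mul_logb_div_nonneg hP hW (r := fun _ : F => (Fintype.card F : ℝ)⁻¹)
    ⟨fun _ => by positivity, by simp [hN.ne']⟩ fun _ _ _ _ => by positivity
  have h1 : ∀ x y, P x * W x y * Real.logb 2 (W x y / (Fintype.card F : ℝ)⁻¹) =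
      P x * W x y * Real.logb 2 (W x y) + P x * W x y * Real.logb 2 (Fintype.card F) := by
    intro x y
    rcases ((hW x).1 y).eq_or_lt with h | hy
    · simp [← h]
    rw [div_inv_eq_mul, Real.logb_mul hy.ne' hN.ne', mul_add]
  simp only [h1, Finset.sum_add_distrib, ← Finset.sum_mul, ← Finset.mul_sum, (hW _).2, mul_one,
    hP.2, one_mul] at h
  simp only [condEntropyBits, ← Finset.mul_sum, mul_assoc] at h ⊢
  linarith

open Classical in
/-- The words that are typical outputs of `W`, have distortion at most `θ` with `x`, and are not
much more likely under `W` given `x` than the conditional entropy predicts. -/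
def coverSet [DecidableEq F] (P : A → ℝ) (W e : A → F → ℝ) (ε τ θ : ℝ) {n : ℕ} (x : Fin n → A) :
    Finset (Fin n → F) :=
  Finset.univ.filter fun y => y ∈ typicalSet (outputLaw P W) ε n ∧
    ∑ t, e (x t) (y t) ≤ n * θ ∧ ∏ t, W (x t) (y t) ≤ 2 ^ (-(n * (condEntropyBits P W - τ)))

/-- The weak law under the joint law, applied to letter frequencies, to the distortion and to `logb
2 (W x y)`, whose mean is minus the conditional entropy. -/
lemma tendsto_iidProb_notMem_coverSet [DecidableEq F] (hP : P ∈ stdSimplex ℝ A) (hW : ∀ x, W x ∈ stdSimplex ℝ F)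
    {e : A → F → ℝ} {ε τ θ : ℝ} (hε : 0 < ε) (hτ : 0 < τ) (hθ : expectedDistortion P e W < θ) :
    Tendsto (fun n => iidProb (jointLaw P W) n
      {z | (fun t => (z t).2) ∉ coverSet P W e ε τ θ fun t => (z t).1}) atTop (𝓝 0) := by
  classical
  have hp := jointLaw_mem_stdSimplex hP hW
  have h1 := tendsto_iidProb_image_not_typical hp Prod.snd (outputLaw P W) (fun y => by
    simp [outputLaw, jointLaw, Fintype.sum_prod_type]) hε
  have h2 := tendsto_iidProb_deviationSet hp (fun z => e z.1 z.2) (sub_pos.2 hθ)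
  have h3 := tendsto_iidProb_deviationSet hp (fun z => Real.logb 2 (W z.1 z.2)) hτ
  have hlim := (h1.add h2).add h3
  simp only [add_zero] at hlim
  refine squeeze_zero (fun n => iidProb_nonneg hp _) (fun n => ?_) hlim
  refine le_trans ?_ ((iidProb_union_le hp _ _).trans
    (add_le_add (iidProb_union_le hp _ _) le_rfl))
  refine iidProb_mono hp fun z hz hpos => ?_
  by_contra hcon
  simp only [Set.mem_union, not_or, deviationSet, Set.mem_ofPred_eq, not_lt] at hcon
  obtain ⟨⟨hc1, hc2⟩, hc3⟩ := hcon
  have hWpos : ∀ t, 0 < W (z t).1 (z t).2 := fun t =>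
    pos_of_mul_pos_right (hpos t) (hP.1 _)
  refine hz (Finset.mem_filter.2 ⟨Finset.mem_univ _, by simpa using hc1, ?_, ?_⟩)
  · have := (abs_le.1 hc2).2
    have hE : ∑ a, jointLaw P W a * e a.1 a.2 = expectedDistortion P e W := by
      simp [jointLaw, expectedDistortion, Fintype.sum_prod_type]
    rw [hE] at this
    linarith
  · have := (abs_le.1 hc3).2
    have hE : ∑ a, jointLaw P W a * Real.logb 2 (W a.1 a.2) = -condEntropyBits P W := by
      simp [jointLaw, condEntropyBits, Fintype.sum_prod_type]
    rw [hE] at this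
    rw [← Real.logb_le_iff_le_rpow (by norm_num) (Finset.prod_pos fun t _ => hWpos t),
      Real.logb_prod _ _ fun t _ => (hWpos t).ne']
    linarith

lemma iidProb_jointLaw {n : ℕ} (E : Set (Fin n → A × F)) :
    iidProb (jointLaw P W) n E = ∑ x : Fin n → A, (∏ t, P (x t)) *
      ∑ y : Fin n → F, {y | (fun t => (x t, y t)) ∈ E}.indicator (fun y => ∏ t, W (x t) (y t)) y := by
  classical
  rw [iidProb, Fintype.sum_equiv (Equiv.arrowProdEquivProdArrow (Fin n) (fun _ => A) fun _ => F) _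
    (fun z => (∏ t, P (z.1 t)) *
      {y | (fun t => (z.1 t, y t)) ∈ E}.indicator (fun y => ∏ t, W (z.1 t) (y t)) z.2),
    Fintype.sum_prod_type]
  · simp only [Finset.mul_sum]
  · intro z
    by_cases hz : z ∈ E
    · have : (Equiv.arrowProdEquivProdArrow (Fin n) (fun _ => A) (fun _ => F) z).2 ∈
          {y | (fun t => ((Equiv.arrowProdEquivProdArrow (Fin n) (fun _ => A) (fun _ => F) z).1 t,
            y t)) ∈ E} := hz
      rw [Set.indicator_of_mem hz, Set.indicator_of_mem this, ← Finset.prod_mul_distrib]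
      rfl
    · have : (Equiv.arrowProdEquivProdArrow (Fin n) (fun _ => A) (fun _ => F) z).2 ∉
          {y | (fun t => ((Equiv.arrowProdEquivProdArrow (Fin n) (fun _ => A) (fun _ => F) z).1 t,
            y t)) ∈ E} := hz
      rw [Set.indicator_of_notMem hz, Set.indicator_of_notMem this, mul_zero]

/-- The source words with few covering words. -/
def sparseSet [DecidableEq F] (P : A → ℝ) (W e : A → F → ℝ) (ε τ θ : ℝ) (n : ℕ) : Set (Fin n → A) :=
  {x | ((coverSet P W e ε τ θ x).card : ℝ) < 2 ^ (n * (condEntropyBits P W - τ)) / 2}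

/-- A covering word has conditional probability at most `2 ^ (-(n * (h - τ)))`. For a sparse source
word they therefore carry at most half of the conditional mass, so the output fails to cover with
conditional probability at least `1 / 2`. -/
lemma iidProb_sparseSet_le [DecidableEq F] (hP : P ∈ stdSimplex ℝ A) (hW : ∀ x, W x ∈ stdSimplex ℝ F)
    {e : A → F → ℝ} {ε τ θ : ℝ} (n : ℕ) :
    iidProb P n (sparseSet P W e ε τ θ n) ≤ 2 * iidProb (jointLaw P W) n
      {z | (fun t => (z t).2) ∉ coverSet P W e ε τ θ fun t => (z t).1} := by
  classical
  rw [iidProb_jointLaw, iidProb, Finset.mul_sum]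
  refine Finset.sum_le_sum fun x _ => ?_
  have hWn : ∀ y : Fin n → F, 0 ≤ ∏ t, W (x t) (y t) := fun y =>
    Finset.prod_nonneg fun t _ => (hW _).1 _
  have hPx := prod_law_nonneg hP x
  have hind : ∑ y : Fin n → F, {y : Fin n → F | (fun t => (x t, y t)) ∈
      {z : Fin n → A × F | (fun t => (z t).2) ∉ coverSet P W e ε τ θ fun t => (z t).1}}.indicator
        (fun y => ∏ t, W (x t) (y t)) y =
      1 - ∑ y ∈ coverSet P W e ε τ θ x, ∏ t, W (x t) (y t) := by
    rw [← sum_prod_channel_eq_one hW x,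
      ← Finset.sum_compl_add_sum (coverSet P W e ε τ θ x) fun y => ∏ t, W (x t) (y t),
      add_sub_cancel_right]
    simp only [Set.indicator_apply, Set.mem_ofPred_eq]
    rw [← Finset.sum_filter]
    exact Finset.sum_congr (by ext; simp) fun _ _ => rfl
  by_cases hx : x ∈ sparseSet P W e ε τ θ n
  · rw [Set.indicator_of_mem hx, hind]
    have h1 : ∑ y ∈ coverSet P W e ε τ θ x, ∏ t, W (x t) (y t) ≤ 1 / 2 := by
      refine (Finset.sum_le_card_nsmul _ _ _ fun y hy => (Finset.mem_filter.1 hy).2.2.2).trans ?_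
      rw [nsmul_eq_mul, Real.rpow_neg (by norm_num), ← div_eq_mul_inv, div_le_iff₀ (by positivity)]
      rw [sparseSet, Set.mem_ofPred_eq] at hx
      linarith
    nlinarith
  · rw [Set.indicator_of_notMem hx]
    exact mul_nonneg zero_le_two (mul_nonneg hPx
      (Finset.sum_nonneg fun y _ => Set.indicator_nonneg (fun y _ => hWn y) y))

lemma tendsto_iidProb_sparseSet [DecidableEq F] (hP : P ∈ stdSimplex ℝ A) (hW : ∀ x, W x ∈ stdSimplex ℝ F)
    {e : A → F → ℝ} {ε τ θ : ℝ} (hε : 0 < ε) (hτ : 0 < τ) (hθ : expectedDistortion P e W < θ) :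
    Tendsto (fun n => iidProb P n (sparseSet P W e ε τ θ n)) atTop (𝓝 0) := by
  refine squeeze_zero (fun n => iidProb_nonneg hP _) (fun n => iidProb_sparseSet_le hP hW n) ?_
  simpa using (tendsto_iidProb_notMem_coverSet hP hW hε hτ hθ).const_mul 2

end TestChannel

/-! ### Transporting the test channel to the field -/

section Relabelling

variable {A B F : Type*}

/-- The channel `W` with its output letters renamed by a section `σ` of `ψ`. -/
def relabelledChannel [DecidableEq F] (W : A → B → ℝ) (ψ : F → B) (σ : B → F) (x : A) (a : F) : ℝ :=
  if σ (ψ a) = a then W x (ψ a) else 0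

variable {ψ : F → B} {σ : B → F}

/-- The relabelled channel charges only the range of `σ`. Hence single-letter sums over `F` collapse
to sums over `B`, and information and distortion are unchanged. -/
lemma sum_eq_sum_section [Fintype B] [Fintype F] (hσ : Function.LeftInverse ψ σ) (g : F → ℝ)
    (hg : ∀ a, σ (ψ a) ≠ a → g a = 0) : ∑ a, g a = ∑ b, g (σ b) := by
  refine (Fintype.sum_of_injective σ hσ.injective _ g (fun a ha => hg a fun h => ?_)
    fun _ => rfl).symm
  exact ha ⟨ψ a, h⟩

lemma relabelledChannel_section [DecidableEq F] (hσ : Function.LeftInverse ψ σ) (W : A → B → ℝ) (x : A) (b : B) :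
    relabelledChannel W ψ σ x (σ b) = W x b := by
  simp [relabelledChannel, hσ b]

variable [Fintype B] [Fintype F] [DecidableEq F]

lemma relabelledChannel_mem_stdSimplex (hσ : Function.LeftInverse ψ σ) {W : A → B → ℝ}
    (hW : ∀ x, W x ∈ stdSimplex ℝ B) (x : A) : relabelledChannel W ψ σ x ∈ stdSimplex ℝ F := by
  constructor
  · intro a
    unfold relabelledChannel
    split_ifs
    exacts [(hW x).1 _, le_rfl]
  · rw [sum_eq_sum_section hσ (relabelledChannel W ψ σ x) fun a ha => if_neg ha]
    simp only [relabelledChannel_section hσ]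
    exact (hW x).2

lemma mutualInfo_relabelledChannel [Fintype A] (hσ : Function.LeftInverse ψ σ) (P : A → ℝ) (W : A → B → ℝ) :
    mutualInfo P (relabelledChannel W ψ σ) = mutualInfo P W := by
  refine Finset.sum_congr rfl fun x _ => ?_
  rw [sum_eq_sum_section hσ _ fun a ha => by simp [relabelledChannel, ha]]
  simp only [outputLaw, relabelledChannel_section hσ]

lemma expectedDistortion_relabelledChannel [Fintype A] (hσ : Function.LeftInverse ψ σ) (P : A → ℝ)
    (d W : A → B → ℝ) :
    expectedDistortion P (fun x a => d x (ψ a)) (relabelledChannel W ψ σ) =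
      expectedDistortion P d W := by
  refine Finset.sum_congr rfl fun x _ => ?_
  rw [sum_eq_sum_section hσ _ fun a ha => by simp [relabelledChannel, ha]]
  simp only [relabelledChannel_section hσ, hσ _]

end Relabelling

/-! ### From served source words to good draws -/

section Draws

variable {A B : Type*} [Fintype A] {q l m n M : ℕ} {k : Fin m → ℕ}

/-- The index tuples of the code with index laws `U`. -/
def indexSet [NeZero q] (U : Fin m → ZMod q → ℝ) (ε : ℝ) (k : Fin m → ℕ) :
    Finset ((i : Fin m) → Fin (k i) → ZMod q) :=
  open Classical in
  Fintype.piFinset fun i => Finset.univ.filter fun u => u ∈ typicalSet (U i) ε (k i)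

lemma mem_indexSet [NeZero q] {U : Fin m → ZMod q → ℝ} {ε : ℝ}
    {u : (i : Fin m) → Fin (k i) → ZMod q} :
    u ∈ indexSet U ε k ↔ ∀ i, u i ∈ typicalSet (U i) ε (k i) := by
  simp [indexSet]

open Classical in
-- For a served source word the decoder recovers the chosen codeword: it is typical, and every
-- typical codeword in its bin equals it. The distortion is then at most `θ`; all other source words
-- cost at most `K` and have total probability at most `η`.
lemma mem_goodDraws_of_served [NeZero q] {P : A → ℝ} (hP : P ∈ stdSimplex ℝ A) {d : A → B → ℝ}
    {K : ℝ} (hK : ∀ x y, d x y ≤ K) (hK0 : 0 ≤ K) (ψ : ZMod q → B) {U : Fin l → Fin m → ZMod q → ℝ}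
    {Q : ZMod q → ℝ} {ε θ η : ℝ} (hθ : 0 ≤ θ) {j : Fin l} (hT : (indexSet (U j) ε k).Nonempty)
    (J : (Fin n → A) → Finset (Fin n → ZMod q))
    (hJQ : ∀ x, ∀ y ∈ J x, y ∈ typicalSet Q ε n)
    (hJd : ∀ x, ∀ y ∈ J x, ∑ t, d (x t) (ψ (y t)) ≤ n * θ) (hn : 0 < n)
    (w : CodeDraw q l m n k M)
    (hw : iidProb P n {x | ¬ Served (nqlcWord j) (indexSet (U j) ε k)
      (Finset.univ.filter fun y => y ∈ typicalSet Q ε n) (J x) ((w.1, w.2.1), w.2.2)} ≤ η) :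
    w ∈ goodDraws P d ψ U Q ε j (θ + K * η) := by
  have hn' : (0 : ℝ) < n := by exact_mod_cast hn
  obtain ⟨u₀, hu₀⟩ := hT
  set S : Finset (Fin n → ZMod q) := Finset.univ.filter fun y => y ∈ typicalSet Q ε n with hS
  have hcode : ∀ u ∈ indexSet (U j) ε k, nqlcWord j (w.1, w.2.1) u ∈ nqlc U ε w.1 w.2.1 j :=
    fun u hu => ⟨u, mem_indexSet.1 hu, rfl⟩
  -- The fallback must also be a codeword, which is why the index set has to be nonempty.
  let enc : (Fin n → A) → Fin n → ZMod q := fun x =>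
    if h : Served (nqlcWord j) (indexSet (U j) ε k) S (J x) ((w.1, w.2.1), w.2.2)
    then nqlcWord j (w.1, w.2.1) h.choose else nqlcWord j (w.1, w.2.1) u₀
  refine ⟨enc, fun x => ?_, ?_⟩
  · simp only [enc]
    split_ifs with h
    · exact hcode _ h.choose_spec.1
    · exact hcode _ hu₀
  have hdec : ∀ x, Served (nqlcWord j) (indexSet (U j) ε k) S (J x) ((w.1, w.2.1), w.2.2) →
      binDecoder (nqlc U ε w.1 w.2.1 j) w.2.2 Q ε (w.2.2 (enc x)) ∈ J x := by
    intro x h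
    have henc : enc x = nqlcWord j (w.1, w.2.1) h.choose := by simp only [enc, dif_pos h]
    obtain ⟨hu, huJ, huniq⟩ := h.choose_spec
    rw [← henc] at huJ huniq
    have hex : ∃! c, c ∈ nqlc U ε w.1 w.2.1 j ∧ w.2.2 c = w.2.2 (enc x) ∧
        c ∈ typicalSet Q ε n := by
      refine ⟨enc x, ⟨henc ▸ hcode _ hu, rfl, hJQ x _ huJ⟩, ?_⟩
      rintro c ⟨⟨u', hu', rfl⟩, hbin, hc⟩
      exact huniq u' (mem_indexSet.2 hu') (Finset.mem_filter.2 ⟨Finset.mem_univ _, hc⟩) hbin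
    rw [binDecoder, dif_pos hex]
    rw [hex.unique hex.choose_spec.1 ⟨henc ▸ hcode _ hu, rfl, hJQ x _ huJ⟩]
    exact huJ
  set E := {x | ¬ Served (nqlcWord j) (indexSet (U j) ε k) S (J x) ((w.1, w.2.1), w.2.2)} with hE
  calc blockDistortion P d _ ≤
        ∑ x : Fin n → A, ((∏ t, P (x t)) * θ + K * E.indicator (fun x => ∏ t, P (x t)) x) := by
        refine Finset.sum_le_sum fun x _ => ?_
        have hPx := prod_law_nonneg hP x
        by_cases hx : x ∈ E
        · rw [Set.indicator_of_mem hx]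
          have : (∑ t, d (x t) (ψ (binDecoder (nqlc U ε w.1 w.2.1 j) w.2.2 Q ε
              (w.2.2 (enc x)) t))) / n ≤ K := by
            rw [div_le_iff₀ hn', mul_comm]
            simpa using Finset.sum_le_card_nsmul Finset.univ _ K fun t _ => hK (x t)
              (ψ (binDecoder (nqlc U ε w.1 w.2.1 j) w.2.2 Q ε (w.2.2 (enc x)) t))
          have h1 := mul_le_mul_of_nonneg_left this hPx
          have h2 := mul_nonneg hPx hθ
          linarith
        · rw [Set.indicator_of_notMem hx, mul_zero, add_zero]
          refine mul_le_mul_of_nonneg_left ?_ hPx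
          rw [div_le_iff₀ hn', mul_comm]
          refine hJd x _ (hdec x ?_)
          simpa [hE] using hx
    _ = θ + K * iidProb P n E := by
        rw [Finset.sum_add_distrib, ← Finset.sum_mul, ← Finset.mul_sum, sum_prod_law_eq_one hP,
          one_mul, iidProb]
    _ ≤ θ + K * η := by
        have := mul_le_mul_of_nonneg_left hw hK0
        linarith

lemma uniformProb_le_one {Ω : Type*} [Finite Ω] (E : Set Ω) : uniformProb E ≤ 1 := by
  refine div_le_one_of_le₀ ?_ (by positivity)
  exact_mod_cast Set.ncard_le_card E

/-- Markov's inequality over a uniform draw: if, except for words from `bad`, every source word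
fails for at most the fraction `β` of all draws, then most draws lie in `E`. -/
lemma le_uniformProb_of_card_fail_le {Ω : Type*} [Finite Ω] [Nonempty Ω] {P : A → ℝ}
    (hP : P ∈ stdSimplex ℝ A) (E : Set Ω) (fail : Ω → (Fin n → A) → Prop) {η β : ℝ} (hη : 0 < η)
    (hβ : 0 ≤ β) (hE : ∀ w, iidProb P n {x | fail w x} ≤ η → w ∈ E) (bad : Set (Fin n → A))
    (hbad : ∀ x ∉ bad, ({w | fail w x}.ncard : ℝ) ≤ Nat.card Ω * β) :
    1 - (iidProb P n bad + β) / η ≤ uniformProb E := by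
  classical
  have := Fintype.ofFinite Ω
  set N : ℝ := (Nat.card Ω : ℝ) with hN
  have hN0 : 0 < N := by rw [hN]; exact_mod_cast Nat.card_pos
  -- Draws outside `E` fail with probability above `η`; exchanging the sums over draws and source
  -- words bounds their number.
  have hcompl : (Eᶜ.ncard : ℝ) * η ≤ N * (iidProb P n bad + β) := by
    calc (Eᶜ.ncard : ℝ) * η = ∑ w ∈ Eᶜ.toFinset, η := by
          rw [Finset.sum_const, nsmul_eq_mul, Set.ncard_eq_toFinset_card']
      _ ≤ ∑ w ∈ Eᶜ.toFinset, iidProb P n {x | fail w x} := by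
          refine Finset.sum_le_sum fun w hw => ?_
          by_contra hlt
          exact (Set.mem_toFinset.1 hw) (hE w (not_le.1 hlt).le)
      _ ≤ ∑ w, iidProb P n {x | fail w x} :=
          Finset.sum_le_sum_of_subset_of_nonneg (Finset.subset_univ _)
            fun w _ _ => iidProb_nonneg hP _
      _ = ∑ x, (∏ t, P (x t)) * ({w | fail w x}.ncard : ℝ) := by
          simp only [iidProb]
          rw [Finset.sum_comm]
          refine Finset.sum_congr rfl fun x _ => ?_
          simp only [Set.indicator_apply, Set.mem_ofPred_eq]
          rw [← Finset.sum_filter, Finset.sum_const, nsmul_eq_mul, mul_comm,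
            Set.ncard_eq_toFinset_card']
          congr 3
          ext; simp
      _ ≤ ∑ x, (N * bad.indicator (fun x => ∏ t, P (x t)) x + (∏ t, P (x t)) * (N * β)) := by
          refine Finset.sum_le_sum fun x _ => ?_
          have hPx := prod_law_nonneg hP x
          by_cases hx : x ∈ bad
          · rw [Set.indicator_of_mem hx]
            have h1 : ({w | fail w x}.ncard : ℝ) ≤ N := by
              rw [hN]
              exact_mod_cast Set.ncard_le_card _
            have h2 := mul_le_mul_of_nonneg_left h1 hPx
            have h3 : 0 ≤ (∏ t, P (x t)) * (N * β) := by positivity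
            linarith
          · rw [Set.indicator_of_notMem hx, mul_zero, zero_add]
            exact mul_le_mul_of_nonneg_left (hbad x hx) hPx
      _ = N * (iidProb P n bad + β) := by
          rw [Finset.sum_add_distrib, ← Finset.mul_sum, ← Finset.sum_mul, sum_prod_law_eq_one hP,
            iidProb]
          ring
  have hadd : (E.ncard : ℝ) + (Eᶜ.ncard : ℝ) = N := by
    rw [hN]
    exact_mod_cast Set.ncard_add_ncard_compl E
  rw [uniformProb, ← hN, le_div_iff₀ hN0, sub_mul, one_mul,
    div_mul_eq_mul_div, sub_le_comm]
  rw [le_div_iff₀ hη]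
  nlinarith

lemma ncard_prodAssoc {Ω₁ Ω₂ Ω₃ : Type*} (p : (Ω₁ × Ω₂) × Ω₃ → Prop) :
    {w : Ω₁ × Ω₂ × Ω₃ | p ((w.1, w.2.1), w.2.2)}.ncard = {w | p w}.ncard := by
  refine Set.ncard_congr (fun w _ => ((w.1, w.2.1), w.2.2)) (fun w hw => by simpa using hw)
    (fun w w' _ _ h => ?_) fun w hw => ⟨(w.1.1, w.1.2, w.2), by simpa using hw, rfl⟩
  simp only [Prod.mk.injEq] at h
  exact Prod.ext h.1.1 (Prod.ext h.1.2 h.2)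

open Classical in
-- The exceptional source words are the sparse ones; for the others the covering set is a large
-- target. The bounds `a`, `s`, `v` on the index set and the typical set stay free.
lemma le_uniformProb_goodDraws [Fact q.Prime] {P : A → ℝ} (hP : P ∈ stdSimplex ℝ A) {d : A → B → ℝ}
    {K : ℝ} (hK : ∀ x y, d x y ≤ K) (hK0 : 0 ≤ K) (ψ : ZMod q → B) {U : Fin l → Fin m → ZMod q → ℝ}
    {W : A → ZMod q → ℝ} {ε τ θ η : ℝ} (hθ : 0 ≤ θ) (hη : 0 < η) {j : Fin l} {a s : ℝ} (ha : 0 < a)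
    (hT : a ≤ (indexSet (U j) ε k).card) (hT' : ((indexSet (U j) ε k).card : ℝ) ≤ s) (hn : 0 < n)
    (hM : 0 < M) {v : ℝ}
    (hv : ((Finset.univ.filter fun y => y ∈ typicalSet (outputLaw P W) ε n).card : ℝ) ≤ v) :
    1 - (iidProb P n (sparseSet P W (fun x y => d x (ψ y)) ε τ θ n) +
      (q ^ n / (a * (2 ^ (n * (condEntropyBits P W - τ)) / 2)) + s * v / (q ^ n * M))) / η ≤
    uniformProb (goodDraws P d ψ U (outputLaw P W) ε j (θ + K * η) : Set (CodeDraw q l m n k M)) := by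
  have hq : (0 : ℝ) < q := by exact_mod_cast (Fact.out : q.Prime).pos
  have hM' : (0 : ℝ) < M := by exact_mod_cast hM
  have hs : 0 ≤ s := ha.le.trans (hT.trans hT')
  have hv0 : 0 ≤ v := le_trans (by positivity) hv
  have hTne : (indexSet (U j) ε k).Nonempty := by
    rw [← Finset.card_pos]
    exact_mod_cast ha.trans_le hT
  have : Nonempty (Fin M) := ⟨⟨0, hM⟩⟩
  set J : (Fin n → A) → Finset (Fin n → ZMod q) :=
    fun x => coverSet P W (fun x y => d x (ψ y)) ε τ θ x with hJ
  set S : Finset (Fin n → ZMod q) :=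
    Finset.univ.filter fun y => y ∈ typicalSet (outputLaw P W) ε n with hS
  have hgood : ∀ w : CodeDraw q l m n k M,
      iidProb P n {x | ¬ Served (nqlcWord j) (indexSet (U j) ε k) S (J x)
        ((w.1, w.2.1), w.2.2)} ≤ η → w ∈ goodDraws P d ψ U (outputLaw P W) ε j (θ + K * η) := by
    intro w hw
    refine mem_goodDraws_of_served hP hK hK0 ψ hθ hTne J ?_ ?_ hn w hw
    · exact fun x y hy => (Finset.mem_filter.1 hy).2.1
    · exact fun x y hy => (Finset.mem_filter.1 hy).2.2.1
  refine le_uniformProb_of_card_fail_le hP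
    (goodDraws P d ψ U (outputLaw P W) ε j (θ + K * η) : Set (CodeDraw q l m n k M))
    (fun w x => ¬ Served (nqlcWord j) (indexSet (U j) ε k) S (J x) ((w.1, w.2.1), w.2.2)) hη
    (by positivity) hgood _ fun x hx => ?_
  have hJx : 2 ^ (n * (condEntropyBits P W - τ)) / 2 ≤ ((J x).card : ℝ) := by
    simpa [sparseSet] using hx
  have hJpos : (0 : ℝ) < (J x).card := lt_of_lt_of_le (by positivity) hJx
  have hJne : (J x).Nonempty := by
    rw [← Finset.card_pos]
    exact_mod_cast hJpos
  have hserved := (pairwiseUniform_nqlcWord (q := q) (m := m) (n := n) (k := k) j).ncard_not_served_le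
    hM (indexSet (U j) ε k) S (J x) hTne hJne
  have hY : (Fintype.card (Fin n → ZMod q) : ℝ) = q ^ n := by simp [ZMod.card]
  rw [hY] at hserved
  have hnc := ncard_prodAssoc fun w => ¬ Served (M := M)
    (nqlcWord (q := q) (m := m) (n := n) (k := k) j) (indexSet (U j) ε k) S (J x) w
  rw [← hnc, Nat.card_congr (Equiv.prodAssoc ((i : Fin m) → Matrix (Fin (k i)) (Fin n) (ZMod q))
    (Fin l → Fin n → ZMod q) ((Fin n → ZMod q) → Fin M))] at hserved
  refine hserved.trans (mul_le_mul_of_nonneg_left ?_ (by positivity))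
  gcongr

end Draws

/-! ### Exponents, lengths and numbers of bins -/

lemma indexSet_uniform_card_bounds {q : ℕ} [Fact q.Prime] {ε : ℝ} {κ : ℕ}
    (hκ : (Fintype.card (ZMod q) : ℝ) ^ κ / 2 ≤
      ((typicalSet (fun _ : ZMod q => (Fintype.card (ZMod q) : ℝ)⁻¹) ε κ).ncard : ℝ)) :
    (q : ℝ) ^ κ / 2 ≤ ((indexSet (fun _ : Fin 1 => fun _ : ZMod q =>
      (Fintype.card (ZMod q) : ℝ)⁻¹) ε fun _ => κ).card : ℝ) ∧
    ((indexSet (fun _ : Fin 1 => fun _ : ZMod q =>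
      (Fintype.card (ZMod q) : ℝ)⁻¹) ε fun _ => κ).card : ℝ) ≤ (q : ℝ) ^ κ := by
  classical
  have hcard : (indexSet (fun _ : Fin 1 => fun _ : ZMod q =>
      (Fintype.card (ZMod q) : ℝ)⁻¹) ε fun _ => κ).card =
      (typicalSet (fun _ : ZMod q => (Fintype.card (ZMod q) : ℝ)⁻¹) ε κ).ncard := by
    rw [indexSet, Fintype.card_piFinset, Fin.prod_univ_one, ← Set.ncard_coe_finset]
    congr
    ext
    simp
  rw [hcard]
  constructor
  · simpa only [ZMod.card] using hκ
  · have := Set.ncard_le_card (typicalSet (fun _ : ZMod q => (Fintype.card (ZMod q) : ℝ)⁻¹) ε κ)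
    rw [Nat.card_eq_fintype_card, Fintype.card_fun, Fintype.card_fin] at this
    simp only [ZMod.card] at this ⊢
    exact_mod_cast this

/-- Up to constants, `q ^ n / (q ^ κ * 2 ^ (n (h - τ)))` and `q ^ κ * 2 ^ (n (H + τ)) / (q ^ n M)`
decay like `2 ^ (- n τ)` when `q ^ κ` and `M` are about `2 ^ (n (log q - h + 2 τ))` and
`2 ^ (n (H - h + 4 τ))`. -/
lemma cover_add_collision_le {q : ℕ} (hq : 2 ≤ q) {h H τ : ℝ} {n κ M : ℕ}
    (hκ : n * (Real.logb 2 q - h + 2 * τ) ≤ κ * Real.logb 2 q)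
    (hκ' : κ * Real.logb 2 q ≤ n * (Real.logb 2 q - h + 2 * τ) + Real.logb 2 q)
    (hM : (2 : ℝ) ^ (n * (H - h + 4 * τ)) / 2 ≤ M) :
    (q : ℝ) ^ n / ((q : ℝ) ^ κ / 2 * (2 ^ (n * (h - τ)) / 2)) +
      (q : ℝ) ^ κ * 2 ^ (n * (H + τ)) / ((q : ℝ) ^ n * M) ≤
    (4 + 2 * q) * (2 ^ (-τ) : ℝ) ^ n := by
  have hq0 : (0 : ℝ) < q := by positivity
  set L := Real.logb 2 q with hL
  have hqL : (2 : ℝ) ^ L = q := Real.rpow_logb (by norm_num) (by norm_num) hq0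
  have hpow : ∀ r : ℕ, (q : ℝ) ^ r = 2 ^ (r * L) := fun r => by
    rw [mul_comm, Real.rpow_mul (by norm_num), hqL, Real.rpow_natCast]
  have h2 : (2 ^ (-τ) : ℝ) ^ n = 2 ^ (-(n * τ)) := by
    rw [← Real.rpow_natCast, ← Real.rpow_mul (by norm_num)]
    congr 1
    ring
  have hM0 : (0 : ℝ) < M := lt_of_lt_of_le (by positivity) hM
  rw [h2, add_mul]
  refine add_le_add ?_ ?_
  -- The constant 4 collects the two halves lost in the sizes of index set and covering set.
  · rw [div_le_iff₀ (by positivity), hpow, hpow]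
    have : (2 : ℝ) ^ (n * L) ≤ 2 ^ (-(n * τ)) * (2 ^ (κ * L) * 2 ^ (n * (h - τ))) := by
      rw [← Real.rpow_add (by norm_num), ← Real.rpow_add (by norm_num)]
      exact Real.rpow_le_rpow_of_exponent_le (by norm_num) (by linarith)
    linarith
  -- In `2 * q`, the factor `q` pays for rounding `κ` up and the 2 for rounding `M` down.
  · rw [div_le_iff₀ (by positivity), hpow, hpow]
    have h3 : (2 : ℝ) ^ (κ * L) * 2 ^ (n * (H + τ)) ≤
        2 ^ L * 2 ^ (-(n * τ)) * (2 ^ (n * L) * 2 ^ (n * (H - h + 4 * τ))) := by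
      rw [← Real.rpow_add (by norm_num), ← Real.rpow_add (by norm_num),
        ← Real.rpow_add (by norm_num), ← Real.rpow_add (by norm_num)]
      exact Real.rpow_le_rpow_of_exponent_le (by norm_num) (by linarith)
    rw [hqL] at h3
    refine h3.trans ?_
    have h4 : (0 : ℝ) ≤ q * 2 ^ (-(n * τ)) * 2 ^ (n * L) := by positivity
    have h5 := mul_le_mul_of_nonneg_left hM h4
    linarith

/-- Fix a test channel `W` to `ZMod q` for the distortion `d x (ψ y)`: one generator matrix and
uniform index laws achieve every rate above its mutual information. -/
lemma tendsto_uniformProb_goodDraws {A B : Type*} [Fintype A] {P : A → ℝ} (hP : P ∈ stdSimplex ℝ A)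
    {d : A → B → ℝ} {K : ℝ} (hK : ∀ x y, d x y ≤ K) (hK0 : 0 ≤ K) {q : ℕ} [Fact q.Prime]
    (ψ : ZMod q → B) {l : ℕ} {W : A → ZMod q → ℝ} (hW : ∀ x, W x ∈ stdSimplex ℝ (ZMod q))
    {ε τ θ η : ℝ} (hε : 0 < ε) (hτ : 0 < τ) (hθ0 : 0 ≤ θ) (hη : 0 < η)
    (hθ : expectedDistortion P (fun x y => d x (ψ y)) W < θ)
    (hετ : ε * ∑ a, |Real.logb 2 (outputLaw P W a)| ≤ τ) {κ M : ℕ → ℕ}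
    (hκt : Tendsto κ atTop atTop)
    (hκ : ∀ n : ℕ, n * (Real.logb 2 q - condEntropyBits P W + 2 * τ) ≤ κ n * Real.logb 2 q)
    (hκ' : ∀ n : ℕ, κ n * Real.logb 2 q ≤
      n * (Real.logb 2 q - condEntropyBits P W + 2 * τ) + Real.logb 2 q)
    (hM : ∀ n : ℕ, (2 : ℝ) ^ (n * (mutualInfo P W + 4 * τ)) / 2 ≤ M n) (j : Fin l) :
    Tendsto (fun n => uniformProb (goodDraws P d ψ
      (fun _ _ _ => (Fintype.card (ZMod q) : ℝ)⁻¹) (outputLaw P W) ε j (θ + K * η) :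
        Set (CodeDraw q l 1 n (fun _ => κ n) (M n)))) atTop (𝓝 1) := by
  classical
  have hq2 : 2 ≤ q := (Fact.out : q.Prime).two_le
  have hq0 : (0 : ℝ) < q := by positivity
  have hsparse := tendsto_iidProb_sparseSet hP hW (e := fun x y => d x (ψ y)) hε hτ hθ
  have hgeom : Tendsto (fun n : ℕ => (4 + 2 * (q : ℝ)) * (2 ^ (-τ) : ℝ) ^ n) atTop (𝓝 0) := by
    have := (tendsto_pow_atTop_nhds_zero_of_lt_one (by positivity)
      (Real.rpow_lt_one_of_one_lt_of_neg one_lt_two (neg_neg_of_pos hτ))).const_mul (4 + 2 * (q : ℝ))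
    simpa using this
  have hlow : Tendsto (fun n : ℕ => 1 - (iidProb P n (sparseSet P W (fun x y => d x (ψ y)) ε τ θ n) +
      (4 + 2 * (q : ℝ)) * (2 ^ (-τ) : ℝ) ^ n) / η) atTop (𝓝 1) := by
    simpa using ((hsparse.add hgeom).div_const η).const_sub 1
  refine tendsto_of_tendsto_of_tendsto_of_le_of_le' hlow tendsto_const_nhds ?_
    (Eventually.of_forall fun n => uniformProb_le_one _)
  filter_upwards [eventually_gt_atTop 0,
    hκt.eventually (eventually_card_typicalSet_uniform (F := ZMod q) hε)] with n hn htyp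
  obtain ⟨hT, hT'⟩ := indexSet_uniform_card_bounds htyp
  have hM0 : 0 < M n := by
    have : (0 : ℝ) < M n := lt_of_lt_of_le (by positivity) (hM n)
    exact_mod_cast this
  have hv : ((Finset.univ.filter fun y => y ∈ typicalSet (outputLaw P W) ε n).card : ℝ) ≤
      2 ^ (n * (entropyBits (outputLaw P W) + τ)) := by
    refine (card_typicalSet_le (outputLaw_mem_stdSimplex hP hW) _
      fun z hz => (Finset.mem_filter.1 hz).2).trans ?_
    refine Real.rpow_le_rpow_of_exponent_le (by norm_num) ?_
    gcongr
  have hmain := le_uniformProb_goodDraws (M := M n) (k := fun _ : Fin 1 => κ n)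
    (U := fun (_ : Fin l) (_ : Fin 1) (_ : ZMod q) => (Fintype.card (ZMod q) : ℝ)⁻¹) (τ := τ)
    hP hK hK0 ψ hθ0 hη (j := j) (by positivity) hT hT' hn hM0 hv
  refine le_trans ?_ hmain
  have hMn := hM n
  rw [mutualInfo_eq_entropyBits_sub hP hW] at hMn
  have := cover_add_collision_le hq2 (hκ n) (hκ' n) hMn
  gcongr

/-- The lengths and bin numbers required by `tendsto_uniformProb_goodDraws` exist. -/
lemma exists_length_bins {L g r : ℝ} (hL : 0 < L) (hg : 0 < g) (hr : 0 ≤ r) :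
    ∃ κ M : ℕ → ℕ, Tendsto κ atTop atTop ∧ (∀ n : ℕ, n * g ≤ κ n * L) ∧
      (∀ n : ℕ, κ n * L ≤ n * g + L) ∧ (∀ n : ℕ, (2 : ℝ) ^ (n * r) / 2 ≤ M n) ∧
      ∀ n : ℕ, 0 < n → 0 < M n ∧ Real.logb 2 (M n) / n ≤ r := by
  refine ⟨fun n => ⌈n * (g / L)⌉₊, fun n => ⌊(2 : ℝ) ^ (n * r)⌋₊, ?_, fun n => ?_, fun n => ?_,
    fun n => ?_, fun n hn => ?_⟩
  · exact tendsto_nat_ceil_atTop.comp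
      (tendsto_natCast_atTop_atTop.atTop_mul_const (div_pos hg hL))
  · have := Nat.le_ceil (n * (g / L))
    rw [← div_le_iff₀ hL, mul_div_assoc]
    exact this
  · have := (Nat.ceil_lt_add_one (a := n * (g / L)) (by positivity)).le
    calc (⌈n * (g / L)⌉₊ : ℝ) * L ≤ (n * (g / L) + 1) * L := by gcongr
      _ = n * g + L := by field_simp
  all_goals
    -- Since `r ≥ 0`, rounding down leaves at least one bin and costs at most a factor 2.
    have h1 : (1 : ℝ) ≤ 2 ^ (n * r) := Real.one_le_rpow (by norm_num) (by positivity)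
    have hfl : 1 ≤ ⌊(2 : ℝ) ^ (n * r)⌋₊ := Nat.le_floor (by simpa using h1)
  · have h2 := Nat.lt_floor_add_one ((2 : ℝ) ^ (n * r))
    have h3 : (1 : ℝ) ≤ (⌊(2 : ℝ) ^ (n * r)⌋₊ : ℝ) := by exact_mod_cast hfl
    linarith
  · refine ⟨hfl, ?_⟩
    have hn' : (0 : ℝ) < n := by exact_mod_cast hn
    have h3 : (0 : ℝ) < (⌊(2 : ℝ) ^ (n * r)⌋₊ : ℝ) := by exact_mod_cast hfl
    rw [div_le_iff₀ hn', mul_comm, Real.logb_le_iff_le_rpow (by norm_num) h3]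
    exact Nat.floor_le (by positivity)

end

/-! ### The achievability theorem -/

theorem mainTheorem5 {A B : Type*} [Fintype A] [Fintype B]
    (P : A → ℝ) (hP : P ∈ stdSimplex ℝ A)
    (d : A → B → ℝ) (hd : ∀ x y, 0 ≤ d x y)
    (q : ℕ) [Fact q.Prime] (ψ : ZMod q → B) (hψ : Function.Surjective ψ)
    (l : ℕ) (hl : 0 < l) (R D : ℝ) (hR : rateDistortion P d D ≤ (R : EReal)) :
    NQLCAchieves P d ψ l R D := by
  intro δ hδ
  -- No minimizer is needed: half of the rate slack pays for a near-optimal channel.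
  obtain ⟨W₀, ⟨hW₀, hdist⟩, hinfo⟩ : ∃ W : A → B → ℝ,
      ((∀ x, W x ∈ stdSimplex ℝ B) ∧ expectedDistortion P d W ≤ D) ∧
        mutualInfo P W < R + δ / 2 := by
    have hlt : rateDistortion P d D < ((R + δ / 2 : ℝ) : EReal) :=
      hR.trans_lt (by exact_mod_cast (by linarith : R < R + δ / 2))
    simp only [rateDistortion, iInf_lt_iff, EReal.coe_lt_coe_iff] at hlt
    obtain ⟨W, hW, h⟩ := hlt
    exact ⟨W, hW, h⟩
  have hσ : Function.LeftInverse ψ (Function.surjInv hψ) := Function.rightInverse_surjInv hψ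
  set W := relabelledChannel W₀ ψ (Function.surjInv hψ) with hWdef
  have hW : ∀ x, W x ∈ stdSimplex ℝ (ZMod q) := relabelledChannel_mem_stdSimplex hσ hW₀
  rw [← mutualInfo_relabelledChannel hσ, ← hWdef] at hinfo
  rw [← expectedDistortion_relabelledChannel hσ, ← hWdef] at hdist
  have hD : 0 ≤ D := le_trans (Finset.sum_nonneg fun x _ => Finset.sum_nonneg fun y _ =>
    mul_nonneg (mul_nonneg (hP.1 x) ((hW x).1 y)) (hd _ _)) hdist
  set K : ℝ := ∑ x, ∑ y, d x y with hKdef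
  have hK0 : 0 ≤ K := Finset.sum_nonneg fun x _ => Finset.sum_nonneg fun y _ => hd x y
  have hK : ∀ x y, d x y ≤ K := fun x y =>
    (Finset.single_le_sum (fun y _ => hd x y) (Finset.mem_univ y)).trans
      (Finset.single_le_sum (f := fun x => ∑ y, d x y)
        (fun x _ => Finset.sum_nonneg fun y _ => hd x y) (Finset.mem_univ x))
  have hq : (1 : ℝ) < q := by exact_mod_cast (Fact.out : q.Prime).one_lt
  have hL : 0 < Real.logb 2 q := Real.logb_pos (by norm_num) hq
  have hcond := condEntropyBits_le_logb_card hP hW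
  rw [ZMod.card] at hcond
  have hI := mutualInfo_nonneg hP hW
  set c := ∑ a, |Real.logb 2 (outputLaw P W a)| with hc
  have hc0 : 0 ≤ c := Finset.sum_nonneg fun a _ => abs_nonneg _
  -- With `τ = δ / 8`, the binning excess `4 * τ` uses up the other half of the rate slack.
  obtain ⟨κ, M, hκt, hκ, hκ', hM, hM'⟩ := exists_length_bins hL
    (g := Real.logb 2 q - condEntropyBits P W + 2 * (δ / 8)) (by linarith)
    (r := mutualInfo P W + 4 * (δ / 8)) (by linarith)
  -- The threshold for `ε` ensures `ε * c ≤ τ`; adding 1 to `c` avoids division by zero.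
  refine ⟨1, fun _ _ _ => (Fintype.card (ZMod q) : ℝ)⁻¹, outputLaw P W, one_pos,
    fun _ _ => ⟨fun _ => by positivity, ?_⟩, outputLaw_mem_stdSimplex hP hW,
    δ / 8 / (c + 1), by positivity, fun ε hε hε₀ => ⟨fun n _ => κ n, M, ?_, fun j => ?_⟩⟩
  · simp [ZMod.card, (zero_lt_one.trans hq).ne']
  · filter_upwards [eventually_gt_atTop 0, hκt.eventually_gt_atTop 0] with n hn hκn
    obtain ⟨h1, h2⟩ := hM' n hn
    exact ⟨fun _ => hκn, h1, by linarith⟩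
  · rw [lt_div_iff₀ (by positivity)] at hε₀
    -- Half of `δ` makes the distortion bound strict for the weak law; the other half pays for
    -- failures, with `K + 1` covering the case `K = 0`.
    have hDelta : D + δ / 2 + K * (δ / (2 * (K + 1))) ≤ D + δ := by
      have : K * (δ / (2 * (K + 1))) ≤ δ / 2 := by
        rw [mul_div_assoc', div_le_div_iff₀ (by positivity) (by positivity)]
        nlinarith
      linarith
    have hlim := tendsto_uniformProb_goodDraws hP hK hK0 ψ hW hε (τ := δ / 8) (θ := D + δ / 2)
      (η := δ / (2 * (K + 1))) (by positivity) (by positivity) (by positivity)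
      (lt_of_le_of_lt hdist (by linarith)) (by linarith) hκt hκ hκ' hM j
    refine tendsto_of_tendsto_of_tendsto_of_le_of_le hlim tendsto_const_nhds (fun n => ?_)
      fun n => uniformProb_le_one _
    refine div_le_div_of_nonneg_right ?_ (by positivity)
    refine Nat.cast_le.2 (Set.ncard_le_ncard (fun w hw => ?_) (Set.toFinite _))
    obtain ⟨enc, h1, h2⟩ := hw
    exact ⟨enc, h1, h2.trans hDelta⟩
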